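/- Let $f:\mathbb R^m\times U\to\mathbb R$, where $U\subseteq\mathbb R^n$ is open and convex (for instance $U=\mathbb R^n$), and let $\mathcal Y\subseteq U$ be nonempty, closed, convex and bounded. Assume that $f$ is $L$-Lipschitz on $\mathbb R^m\times U$ for the Euclidean norm ($L>0$), that $f(\cdot,\mathbf y)+\frac{\rho}{2}\|\cdot\|^2$ is convex for every $\mathbf y\in\mathcal Y$ ($\rho>0$), and that for every $\mathbf x$ the function $f(\mathbf x,\cdot)$ is concave on $U$ and $\mu$-strongly concave on $\mathcal Y$ ($\mu>0$). Put $\Phi(\mathbf x)=\max_{\mathbf y\in\mathcal Y}f(\mathbf x,\mathbf y)$, assume that $\Phi$ is bounded below, let $\Phi_{1/2\rho}(\mathbf x)=\min_{\mathbf w}\{\Phi(\mathbf w)+\rho\|\mathbf w-\mathbf x\|^2\}$ be its Moreau envelope, and let $\Delta_\Phi=\Phi(\mathbf x_0)-\inf\Phi$. A point $\mathbf x$ is $\epsilon$-stationary if $\|\nabla\Phi_{1/2\rho}(\mathbf x)\|\le\epsilon$. A subgradient of $f$ at $(\mathbf x,\mathbf y)$, $\mathbf y\in\mathcal Y$, is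 a pair $(\mathbf g_{\mathbf x},\mathbf g_{\mathbf y})$ with $\mathbf g_{\mathbf x}\in\partial_{\mathbf x}f(\mathbf x,\mathbf y)$, i.e. $\mathbf g_{\mathbf x}+\rho\mathbf x$ is a convex subgradient of $f(\cdot,\mathbf y)+\frac{\rho}{2}\|\cdot\|^2$ at $\mathbf x$, and $\mathbf g_{\mathbf y}\in\partial_{\mathbf y}f(\mathbf x,\mathbf y)$, i.e. $f(\mathbf x,\mathbf y')\le f(\mathbf x,\mathbf y)+\langle\mathbf g_{\mathbf y},\mathbf y'-\mathbf y\rangle$ for all $\mathbf y'\in U$. For $\epsilon,S>0$ let $$\eta_{\mathbf x}(S)=\min\left\{\tfrac{\epsilon^2}{48\rho S},\ \tfrac{\mu\epsilon^4}{4096\rho^2S^2},\ \tfrac{\mu\epsilon^4}{4096\rho^2S^2\log^2(1+4096\rho^2S^2\mu^{-2}\epsilon^{-4})}\right\},\qquad B=\left\lfloor\sqrt{\tfrac{1}{\mu\,\eta_{\mathbf x}(S)}}\right\rfloor+1,$$ $$\eta_{\mathbf y}^t=\tfrac{1}{\mu(t-jB)}\quad\text{for } jB+1\le t\le(j+1)B,\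 j=0,1,2,\dots,$$ $$N(S)=\tfrac{\rho S\Delta_\Phi}{\epsilon^4}\max\left\{1,\ \tfrac{\rho S}{\mu\epsilon^2},\ \tfrac{\rho S}{\mu\epsilon^2}\log^2\left(1+\tfrac{\rho^2S^2}{\mu^2\epsilon^4}\right)\right\}.$$ Let $\mathbf x_0\in\mathbb R^m$ and $\mathbf y_0\in\mathcal Y$. Then $\Phi$ is $\rho$-weakly convex, $\Phi_{1/2\rho}$ is differentiable, and there is an absolute constant $C>0$ (independent of $m,n,f,U,\mathcal Y,L,\rho,\mu,\sigma,\epsilon,\mathbf x_0,\mathbf y_0$) such that the following statements hold. 1. (TTGDA) Let $S=L^2$ and, for $t=1,2,\dots$, let $\mathbf x_t=\mathbf x_{t-1}-\eta_{\mathbf x}(S)\,\mathbf g_{\mathbf x}^{t-1}$ and $\mathbf y_t=\mathcal P_{\mathcal Y}(\mathbf y_{t-1}+\eta_{\mathbf y}^t\,\mathbf g_{\mathbf y}^{t-1})$, where $(\mathbf g_{\mathbf x}^{t-1},\mathbf g_{\mathbf y}^{t-1})$ is any subgradient of $f$ at $(\mathbf x_{t-1},\mathbf y_{t-1})$. Then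 for every number $T\ge\lfloor C\,N(L^2)\rfloor$ of iterations (that is, of subgradient evaluations), $$\frac{1}{T+1}\sum_{t=0}^{T}\|\nabla\Phi_{1/2\rho}(\mathbf x_t)\|^2\le\epsilon^2,$$ and in particular some $\mathbf x_t$ with $t\le T$ is an $\epsilon$-stationary point. So $O(N(L^2))$ subgradient evaluations suffice. 2. (TTSGDA with batch size $M=1$) Let $\sigma\ge0$, $S=L^2+\sigma^2$, let $\xi_0,\xi_1,\dots$ be i.i.d. samples, and let $G=(G_{\mathbf x},G_{\mathbf y})$ be measurable with, for all $\mathbf x\in\mathbb R^m$ and $\mathbf y\in\mathcal Y$, $\mathbb E[G(\mathbf x,\mathbf y,\xi)]$ a subgradient of $f$ at $(\mathbf x,\mathbf y)$ and $\mathbb E\|G(\mathbf x,\mathbf y,\xi)-\mathbb E[G(\mathbf x,\mathbf y,\xi)]\|^2\le\sigma^2$. For $t=1,2,\dots$ let $\mathbf x_t=\mathbf x_{t-1}-\eta_{\mathbf x}(S)\,G_{\mathbf x}(\mathbf x_{t-1},\mathbf y_{t-1},\xi_{t-1})$ and $\mathbf y_t=\mathcal P_{\mathcal Y}(\mathbf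 y_{t-1}+\eta_{\mathbf y}^t\,G_{\mathbf y}(\mathbf x_{t-1},\mathbf y_{t-1},\xi_{t-1}))$. Then for every number $T\ge\lfloor C\,N(L^2+\sigma^2)\rfloor$ of iterations (that is, of stochastic subgradient evaluations), $$\frac{1}{T+1}\sum_{t=0}^{T}\mathbb E\|\nabla\Phi_{1/2\rho}(\mathbf x_t)\|^2\le\epsilon^2,$$ where the integrands are integrable. So $O(N(L^2+\sigma^2))$ stochastic subgradient evaluations suffice. In both cases, the left-hand side is $\mathbb E\|\nabla\Phi_{1/2\rho}(\hat{\mathbf x})\|^2$ for the output $\hat{\mathbf x}$ drawn uniformly at random from $\{\mathbf x_t\}_{t=0}^T$. -/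

import Mathlib

open MeasureTheory ProbabilityTheory

noncomputable section

namespace TwoTimescale

section Objects

variable {E F : Type*} [NormedAddCommGroup E] [InnerProductSpace ℝ E]
  [NormedAddCommGroup F] [InnerProductSpace ℝ F]

/-- `h` is `ρ`-weakly convex: `h + (ρ / 2) ‖·‖²` is convex. -/
def WeaklyConvex (ρ : ℝ) (h : E → ℝ) : Prop :=
  ConvexOn ℝ Set.univ (fun x => h x + ρ / 2 * ‖x‖ ^ 2)

/-- The subdifferential of convex analysis of a function on the whole space. -/
def convexSubdifferential (h : E → ℝ) (x : E) : Set E :=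
  {g | ∀ x' : E, h x + inner ℝ g (x' - x) ≤ h x'}

/-- The subdifferential of a `ρ`-weakly convex function `h`, given by
`∂ h (x) = ∂ (h + (ρ / 2) ‖·‖²) (x) - ρ x`. For such `h` it is the Clarke subdifferential and does
not depend on the choice of the admissible `ρ`. -/
def weakSubdifferential (ρ : ℝ) (h : E → ℝ) (x : E) : Set E :=
  {g | g + ρ • x ∈ convexSubdifferential (fun w => h w + ρ / 2 * ‖w‖ ^ 2) x}

/-- The superdifferential at `y` of a concave function `h` with domain `U`. -/
def superdifferentialOn (U : Set F) (h : F → ℝ) (y : F) : Set F :=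
  {g | ∀ y' ∈ U, h y' ≤ h y + inner ℝ g (y' - y)}

/-- `(gx, gy)` is a subgradient of `f` at `(x, y)`: `gx ∈ ∂_x f (x, y)` and
`gy ∈ ∂_y f (x, y)`, where `f` is `ρ`-weakly convex in `x` and concave in `y ∈ U`. -/
def IsSubgradient (f : E → F → ℝ) (U : Set F) (ρ : ℝ) (x : E) (y : F) (gx : E) (gy : F) : Prop :=
  gx ∈ weakSubdifferential ρ (fun x' => f x' y) x ∧ gy ∈ superdifferentialOn U (f x) y

/-- `p` is the Euclidean projection of `z` onto `Y`. -/
def IsProjection (Y : Set F) (z p : F) : Prop :=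
  p ∈ Y ∧ ∀ y ∈ Y, ‖z - p‖ ≤ ‖z - y‖

/-- The standing assumptions on the problem `min_x max_{y ∈ Y} f (x, y)`.
The set `U` is an open convex set containing `Y`, on which `f` is given in the variable `y`
(for instance the whole space); strong concavity is required on the constraint set only, since no
function is both Lipschitz and strongly concave on a whole space of positive dimension. -/
structure Assumptions (f : E → F → ℝ) (U Y : Set F) (L ρ μ : ℝ) : Prop where
  L_pos : 0 < L
  rho_pos : 0 < ρ
  mu_pos : 0 < μ
  isOpen_U : IsOpen U
  subset : Y ⊆ U
  nonempty : Y.Nonempty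
  isClosed : IsClosed Y
  convex : Convex ℝ Y
  bounded : Bornology.IsBounded Y
  /-- `f` is `L`-Lipschitz for the Euclidean norm of the pair `(x, y)`. -/
  lipschitz : ∀ x x' : E, ∀ y ∈ U, ∀ y' ∈ U,
    |f x y - f x' y'| ≤ L * √(‖x - x'‖ ^ 2 + ‖y - y'‖ ^ 2)
  weaklyConvex : ∀ y ∈ Y, WeaklyConvex ρ (fun x => f x y)
  concave : ∀ x : E, ConcaveOn ℝ U (f x)
  stronglyConcave : ∀ x : E, StrongConcaveOn Y μ (f x)

/-- `Φ (x) = max_{y ∈ Y} f (x, y)`. -/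
def Phi (f : E → F → ℝ) (Y : Set F) (x : E) : ℝ :=
  sSup (f x '' Y)

/-- `Δ_Φ = Φ (x₀) - inf Φ`. -/
def DeltaPhi (f : E → F → ℝ) (Y : Set F) (x₀ : E) : ℝ :=
  Phi f Y x₀ - ⨅ x : E, Phi f Y x

/-- The Moreau envelope `Φ_lam (x) = min_w Φ (w) + ‖w - x‖² / (2 lam)`. -/
def moreauEnvelope (lam : ℝ) (Φ : E → ℝ) (x : E) : ℝ :=
  ⨅ w : E, (Φ w + 1 / (2 * lam) * ‖w - x‖ ^ 2)

/-- The stationarity measure `‖∇ Φ_{1/(2ρ)} (x)‖`. -/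
def stationarity [CompleteSpace E] (ρ : ℝ) (Φ : E → ℝ) (x : E) : ℝ :=
  ‖gradient (moreauEnvelope (1 / (2 * ρ)) Φ) x‖

/-- `x` is an `ε`-stationary point of the `ρ`-weakly convex function `Φ`. -/
def IsStationaryPoint [CompleteSpace E] (ε ρ : ℝ) (Φ : E → ℝ) (x : E) : Prop :=
  stationarity ρ Φ x ≤ ε

/-- `(x t, y t)`, `t = 0, 1, 2, …`, are the iterates of TTGDA started at `(x₀, y₀)`. The iteration
that produces `(x t, y t)` from `(x (t - 1), y (t - 1))`, for `t = 1, 2, …`, evaluates one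
subgradient and has the step sizes `ηx t` and `ηy t`. -/
structure IsTTGDA (f : E → F → ℝ) (U Y : Set F) (ρ : ℝ) (ηx ηy : ℕ → ℝ) (x₀ : E) (y₀ : F)
    (x : ℕ → E) (y : ℕ → F) : Prop where
  x_zero : x 0 = x₀
  y_zero : y 0 = y₀
  step : ∀ t : ℕ, ∃ (gx : E) (gy : F), IsSubgradient f U ρ (x t) (y t) gx gy ∧
    x (t + 1) = x t - ηx (t + 1) • gx ∧
    IsProjection Y (y t + ηy (t + 1) • gy) (y (t + 1))

/-- `G = (Gx, Gy)` with a random sample of law `ν` is an unbiased stochastic subgradient of `f` with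
variance at most `σ²`. -/
structure IsStochasticSubgradient {Ξ : Type*} [MeasurableSpace Ξ] [MeasurableSpace E]
    [MeasurableSpace F] (f : E → F → ℝ) (U Y : Set F) (ρ σ : ℝ) (ν : Measure Ξ)
    (Gx : E → F → Ξ → E) (Gy : E → F → Ξ → F) : Prop where
  measurable_x : Measurable (fun p : E × F × Ξ => Gx p.1 p.2.1 p.2.2)
  measurable_y : Measurable (fun p : E × F × Ξ => Gy p.1 p.2.1 p.2.2)
  memLp_x : ∀ x : E, ∀ y ∈ Y, MemLp (Gx x y) 2 ν
  memLp_y : ∀ x : E, ∀ y ∈ Y, MemLp (Gy x y) 2 ν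
  unbiased : ∀ x : E, ∀ y ∈ Y, IsSubgradient f U ρ x y (∫ s, Gx x y s ∂ν) (∫ s, Gy x y s ∂ν)
  variance_le : ∀ x : E, ∀ y ∈ Y,
    ∫ s, (‖Gx x y s - ∫ s', Gx x y s' ∂ν‖ ^ 2 + ‖Gy x y s - ∫ s', Gy x y s' ∂ν‖ ^ 2) ∂ν ≤ σ ^ 2

/-- `(X t, V t)`, `t = 0, 1, 2, …`, are the (random) iterates of TTSGDA with batch size `1` started
at `(x₀, y₀)`, driven by the samples `ξ 0, ξ 1, …`; one stochastic subgradient per iteration. -/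
structure IsTTSGDA {Ω Ξ : Type*} (Gx : E → F → Ξ → E) (Gy : E → F → Ξ → F) (Y : Set F)
    (ηx ηy : ℕ → ℝ) (x₀ : E) (y₀ : F) (ξ : ℕ → Ω → Ξ) (X : ℕ → Ω → E) (V : ℕ → Ω → F) : Prop where
  x_zero : ∀ ω, X 0 ω = x₀
  y_zero : ∀ ω, V 0 ω = y₀
  x_step : ∀ t ω, X (t + 1) ω = X t ω - ηx (t + 1) • Gx (X t ω) (V t ω) (ξ t ω)
  y_step : ∀ t ω,
    IsProjection Y (V t ω + ηy (t + 1) • Gy (X t ω) (V t ω) (ξ t ω)) (V (t + 1) ω)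

end Objects

/-- The constant step size `ηx`; `S = L²` for TTGDA and `S = L² + σ²` for TTSGDA. -/
def stepX (ρ μ S ε : ℝ) : ℝ :=
  min (ε ^ 2 / (48 * ρ * S))
    (min (μ * ε ^ 4 / (4096 * ρ ^ 2 * S ^ 2))
      (μ * ε ^ 4 / (4096 * ρ ^ 2 * S ^ 2 *
        Real.log (1 + 4096 * ρ ^ 2 * S ^ 2 / (μ ^ 2 * ε ^ 4)) ^ 2)))

/-- The epoch length `B = ⌊√(1 / (μ ηx))⌋ + 1`. -/
def epochLength (μ ηx : ℝ) : ℕ :=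
  ⌊√(1 / (μ * ηx))⌋₊ + 1

/-- The restarted step size `1 / (μ (t - j B))` for `j B + 1 ≤ t ≤ (j + 1) B`; it is used for
`t ≥ 1` only. -/
def stepY (μ : ℝ) (B t : ℕ) : ℝ :=
  1 / (μ * ((t : ℝ) - (((t - 1) / B : ℕ) : ℝ) * (B : ℝ)))

/-- The complexity bound
`(ρ S Δ / ε⁴) max {1, ρ S / (μ ε²), (ρ S / (μ ε²)) log² (1 + ρ² S² / (μ² ε⁴))}`. -/
def complexity (ρ μ S Δ ε : ℝ) : ℝ :=
  ρ * S * Δ / ε ^ 4 *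
    max 1 (max (ρ * S / (μ * ε ^ 2))
      (ρ * S / (μ * ε ^ 2) * Real.log (1 + ρ ^ 2 * S ^ 2 / (μ ^ 2 * ε ^ 4)) ^ 2))

end TwoTimescale

end

noncomputable section

set_option linter.unusedSectionVars false

namespace TwoTimescale

/-! ### Elementary inequalities -/

/-! The Moreau envelope of `Φ`, evaluated along the x-iterates, is a Lyapunov function. Using the
proximal point of the current iterate as competitor at the next one, an iteration lowers its mean by
`η / 4` times the mean squared gradient norm, up to `2 ρ η` times the mean gap `Φ(x_t) - f(x_t,
y_t)` and a term `ρ η² S` (`integral_moreauEnvelope_succ_le`). It remains to keep the average gap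
below a small multiple of `ε² / ρ`.

As `f` need not be smooth, the maximizer of `f(x, ·)` need not move at a Lipschitz rate in `x`.
Hence, throughout an epoch, the y-iterates are compared with one fixed point, the maximizer at the
x-iterate that opens the epoch. The drift of `x` then costs at most `η S B²` per epoch, and
projected ascent with steps `1 / (μ i)` has regret at most `(S / 2μ)(1 + log B)`. The initial
distance enters this regret with weight zero, so restarts are free and the diameter of `Y` never
appears (`integral_gap_le`, `sum_integral_gap_le`).

Per iteration the gap is thus about `η S B + (S / 2μ)(1 + log B) / B`, which `B ≈ (μ η)^(-1/2)`
nearly balances. With `κ = ρ S / (μ ε²)`, the step size forces `B ≥ 64 κ max(1, log(1 + 4096 κ²))`,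
which makes both terms small (`epochLength_mul_log_le`). Telescoping the descent gives the rate
(`average_le`). A horizon shorter than one epoch needs another argument: there the lower bound on
`T` makes `Δ` so small that every iterate is already nearly stationary.

Both algorithms are instances of `IsMeanSubgradientProcess`, which asks for the subgradient
inequalities in mean only, at test points determined by past iterates: TTGDA over a Dirac mass,
TTSGDA by independence of the new sample from the past. -/

theorem le_of_forall_pos_lt_one_le_add_mul {x y k : ℝ}
    (h : ∀ a : ℝ, 0 < a → a < 1 → x ≤ y + a * k) : x ≤ y := by
  refine le_of_forall_pos_le_add fun δ hδ => ?_
  have hk : 0 < |k| + 1 := by positivity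
  have ha : 0 < min (1 / 2) (δ / (|k| + 1)) := by positivity
  refine (h _ ha (lt_of_le_of_lt (min_le_left _ _) (by norm_num))).trans ?_
  have h1 : min (1 / 2) (δ / (|k| + 1)) * k ≤ δ / (|k| + 1) * (|k| + 1) :=
    (mul_le_mul_of_nonneg_left ((le_abs_self k).trans (by linarith)) ha.le).trans
      (mul_le_mul_of_nonneg_right (min_le_right _ _) hk.le)
  rw [div_mul_cancel₀ _ hk.ne'] at h1
  linarith

section Geometry

variable {E F : Type*} [NormedAddCommGroup E] [InnerProductSpace ℝ E]
  [NormedAddCommGroup F] [InnerProductSpace ℝ F]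

theorem norm_convexCombination_sub_sq (a : ℝ) (p w x : E) :
    ‖(1 - a) • p + a • w - x‖ ^ 2 =
      (1 - a) * ‖p - x‖ ^ 2 + a * ‖w - x‖ ^ 2 - a * (1 - a) * ‖w - p‖ ^ 2 := by
  have h1 : (1 - a) • p + a • w - x = (1 - a) • (p - x) + a • (w - x) := by module
  have h2 : w - p = (w - x) - (p - x) := by abel
  rw [h1, h2]
  generalize p - x = v
  generalize w - x = v'
  rw [norm_add_sq_real, norm_sub_sq_real, norm_smul, norm_smul, mul_pow, mul_pow,
    Real.norm_eq_abs, Real.norm_eq_abs, sq_abs, sq_abs, real_inner_smul_left,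
    real_inner_smul_right, real_inner_comm v v']
  ring

theorem norm_convexCombination_sq (a : ℝ) (p w : E) :
    ‖(1 - a) • p + a • w‖ ^ 2 =
      (1 - a) * ‖p‖ ^ 2 + a * ‖w‖ ^ 2 - a * (1 - a) * ‖w - p‖ ^ 2 := by
  simpa using norm_convexCombination_sub_sq a p w 0

theorem WeaklyConvex.le_convexCombination {ρ : ℝ} {φ : E → ℝ} (h : WeaklyConvex ρ φ) (p w : E)
    {a : ℝ} (ha : 0 < a) (ha1 : a < 1) :
    φ ((1 - a) • p + a • w) ≤ (1 - a) * φ p + a * φ w + ρ / 2 * (a * (1 - a) * ‖w - p‖ ^ 2) := by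
  have := h.2 (Set.mem_univ p) (Set.mem_univ w) (by linarith : (0 : ℝ) ≤ 1 - a) ha.le (by ring)
  simp only [smul_eq_mul, norm_convexCombination_sq] at this
  linarith

/-! ### Projections -/

theorem IsProjection.inner_nonpos {Y : Set F} (hY : Convex ℝ Y) {z p u : F}
    (hp : IsProjection Y z p) (hu : u ∈ Y) : inner ℝ (z - p) (u - p) ≤ 0 := by
  -- First-order condition without derivatives: compare `p` with `(1 - a) p + a u`, divide by `a`
  -- and let `a → 0`. The same device gives the quadratic growth and strong supergradient
  -- inequalities below.
  refine le_of_forall_pos_lt_one_le_add_mul (k := ‖u - p‖ ^ 2 / 2) fun a ha ha1 => ?_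
  have h1 := hp.2 _ (hY hp.1 hu (by linarith : (0 : ℝ) ≤ 1 - a) ha.le (by ring))
  have h2 : z - ((1 - a) • p + a • u) = (z - p) - a • (u - p) := by module
  have h3 := pow_le_pow_left₀ (norm_nonneg _) h1 2
  rw [h2, norm_sub_sq_real (z - p), real_inner_smul_right, norm_smul, mul_pow, Real.norm_eq_abs,
    sq_abs] at h3
  have h4 : a * inner ℝ (z - p) (u - p) ≤ a * (0 + a * (‖u - p‖ ^ 2 / 2)) := by nlinarith
  exact le_of_mul_le_mul_left h4 ha

theorem IsProjection.norm_sub_le_norm_sub {Y : Set F} (hY : Convex ℝ Y) {z p z' p' : F}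
    (hp : IsProjection Y z p) (hp' : IsProjection Y z' p') : ‖p - p'‖ ≤ ‖z - z'‖ := by
  have h1 := hp.inner_nonpos hY hp'.1
  have h2 := hp'.inner_nonpos hY hp.1
  have h3 : inner ℝ (z - z') (p - p') =
      ‖p - p'‖ ^ 2 - inner ℝ (z - p) (p' - p) - inner ℝ (z' - p') (p - p') := by
    rw [← real_inner_self_eq_norm_sq]
    simp only [inner_sub_left, inner_sub_right]
    ring
  have h4 := real_inner_le_norm (z - z') (p - p')
  rcases (norm_nonneg (p - p')).eq_or_lt with h | h
  · rw [← h]; positivity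
  · nlinarith

theorem exists_isProjection [ProperSpace F] {Y : Set F} (hY : IsClosed Y) (hne : Y.Nonempty)
    (z : F) : ∃ p, IsProjection Y z p := by
  obtain ⟨p, hp, hd⟩ := hY.exists_infDist_eq_dist hne z
  refine ⟨p, hp, fun y hy => ?_⟩
  rw [← dist_eq_norm, ← dist_eq_norm, ← hd]
  exact Metric.infDist_le_dist_of_mem hy

/-! ### The Moreau envelope of a weakly convex function -/

/-- `p` attains the minimum that defines the Moreau envelope of parameter `1 / (2 ρ)` at `x`. -/
def IsProx (ρ : ℝ) (φ : E → ℝ) (x p : E) : Prop :=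
  ∀ w, φ p + ρ * ‖p - x‖ ^ 2 ≤ φ w + ρ * ‖w - x‖ ^ 2

theorem exists_isProx [ProperSpace E] {ρ : ℝ} (hρ : 0 < ρ) {φ : E → ℝ} (hc : Continuous φ)
    (hb : BddBelow (Set.range φ)) (x : E) : ∃ p, IsProx ρ φ x p := by
  obtain ⟨b, hb⟩ := hb
  refine Continuous.exists_forall_le (f := fun w => φ w + ρ * ‖w - x‖ ^ 2) (by fun_prop) ?_
  refine Filter.tendsto_atTop_add_left_of_le _ b (fun w => hb ⟨w, rfl⟩) ?_
  refine Filter.Tendsto.const_mul_atTop hρ ((Filter.tendsto_pow_atTop two_ne_zero).comp ?_)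
  simpa [← dist_eq_norm] using tendsto_dist_right_cocompact_atTop x

variable {ρ : ℝ} {φ : E → ℝ}

theorem IsProx.moreauEnvelope_eq {x p : E} (hp : IsProx ρ φ x p) (hρ : 0 < ρ) :
    moreauEnvelope (1 / (2 * ρ)) φ x = φ p + ρ * ‖p - x‖ ^ 2 := by
  have hc : 1 / (2 * (1 / (2 * ρ))) = ρ := by field_simp
  rw [moreauEnvelope, hc]
  exact le_antisymm (ciInf_le ⟨_, Set.forall_mem_range.2 hp⟩ p) (le_ciInf hp)

theorem moreauEnvelope_le {x p : E} (hp : IsProx ρ φ x p) (hρ : 0 < ρ) (w : E) :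
    moreauEnvelope (1 / (2 * ρ)) φ x ≤ φ w + ρ * ‖w - x‖ ^ 2 :=
  (hp.moreauEnvelope_eq hρ).trans_le (hp w)

/-- The term `ρ ‖· - x‖²` is `2ρ`-strongly convex and `φ` loses at most `ρ`, so the proximal
objective is `ρ`-strongly convex and grows quadratically from its minimizer. -/
theorem IsProx.add_norm_sq_le {x p : E} (hp : IsProx ρ φ x p) (hφ : WeaklyConvex ρ φ) (w : E) :
    φ p + ρ * ‖p - x‖ ^ 2 + ρ / 2 * ‖w - p‖ ^ 2 ≤ φ w + ρ * ‖w - x‖ ^ 2 := by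
  refine le_of_forall_pos_lt_one_le_add_mul (k := ρ / 2 * ‖w - p‖ ^ 2) fun a ha ha1 => ?_
  have h1 := hp ((1 - a) • p + a • w)
  have h2 := hφ.le_convexCombination p w ha ha1
  rw [norm_convexCombination_sub_sq] at h1
  refine le_of_mul_le_mul_left ?_ ha
  nlinarith

/-- Adding the two growth inequalities, each tested at the other minimizer, cancels `φ` and leaves
`ρ ‖p' - p‖² ≤ 2ρ ⟨p' - p, x' - x⟩`. -/
theorem IsProx.norm_sub_le {x p x' p' : E} (hρ : 0 < ρ) (hφ : WeaklyConvex ρ φ)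
    (hp : IsProx ρ φ x p) (hp' : IsProx ρ φ x' p') : ‖p' - p‖ ≤ 2 * ‖x' - x‖ := by
  have h1 := hp.add_norm_sq_le hφ p'
  have h2 := hp'.add_norm_sq_le hφ p
  rw [norm_sub_rev p p'] at h2
  have h3 : ‖p' - x‖ ^ 2 - ‖p - x‖ ^ 2 + ‖p - x'‖ ^ 2 - ‖p' - x'‖ ^ 2 =
      2 * inner ℝ (p' - p) (x' - x) := by
    simp only [← real_inner_self_eq_norm_sq, inner_sub_left, inner_sub_right,
      real_inner_comm p x, real_inner_comm p x', real_inner_comm p' x, real_inner_comm p' x']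
    ring
  have h4 := real_inner_le_norm (p' - p) (x' - x)
  have h5 : ρ * ‖p' - p‖ ^ 2 ≤ ρ * (2 * inner ℝ (p' - p) (x' - x)) := by
    rw [← h3]; linarith
  have h6 := le_of_mul_le_mul_left h5 hρ
  rcases (norm_nonneg (p' - p)).eq_or_lt with h | h
  · rw [← h]; positivity
  · nlinarith

/-- The minimizer at `x` is a competitor at `x + h`, and conversely. This sandwiches the increment
around its linear part; the error is quadratic in `h` because the proximal map is Lipschitz. -/
theorem hasGradientAt_moreauEnvelope [CompleteSpace E] (hρ : 0 < ρ) (hφ : WeaklyConvex ρ φ)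
    (hex : ∀ x, ∃ p, IsProx ρ φ x p) {x p : E} (hp : IsProx ρ φ x p) :
    HasGradientAt (moreauEnvelope (1 / (2 * ρ)) φ) ((2 * ρ) • (x - p)) x := by
  rw [hasGradientAt_iff_isLittleO_nhds_zero]
  have key : ∀ h : E, ‖moreauEnvelope (1 / (2 * ρ)) φ (x + h) - moreauEnvelope (1 / (2 * ρ)) φ x -
      inner ℝ ((2 * ρ) • (x - p)) h‖ ≤ 5 * ρ * ‖‖h‖ ^ 2‖ := by
    intro h
    obtain ⟨p', hp'⟩ := hex (x + h)
    have e1 : ‖p - (x + h)‖ ^ 2 = ‖p - x‖ ^ 2 + 2 * inner ℝ (x - p) h + ‖h‖ ^ 2 := by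
      rw [← sub_sub, norm_sub_sq_real, ← neg_sub x p, inner_neg_left, norm_neg]; ring
    have e2 : ‖p' - (x + h)‖ ^ 2 = ‖p' - x‖ ^ 2 + 2 * inner ℝ (x - p) h
        - 2 * inner ℝ (p' - p) h + ‖h‖ ^ 2 := by
      rw [← sub_sub, norm_sub_sq_real]
      simp only [inner_sub_left]; ring
    have h1 := moreauEnvelope_le hp' hρ p
    have h2 := moreauEnvelope_le hp hρ p'
    have h3 := hp.moreauEnvelope_eq hρ
    have h4 := hp'.moreauEnvelope_eq hρ
    have h5 := IsProx.norm_sub_le hρ hφ hp hp'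
    rw [add_sub_cancel_left] at h5
    have h6 : inner ℝ (p' - p) h ≤ 2 * ‖h‖ ^ 2 :=
      (real_inner_le_norm _ _).trans (by nlinarith [norm_nonneg h])
    rw [e1] at h1
    rw [e2] at h4
    rw [real_inner_smul_left, Real.norm_eq_abs, Real.norm_eq_abs, abs_of_nonneg (sq_nonneg ‖h‖),
      abs_le]
    have h7 := mul_le_mul_of_nonneg_left h6 hρ.le
    have h8 := mul_nonneg hρ.le (sq_nonneg ‖h‖)
    constructor <;> linarith
  refine (Asymptotics.isBigO_of_le' _ key).trans_isLittleO ?_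
  exact Asymptotics.isLittleO_norm_pow_id one_lt_two

theorem differentiable_moreauEnvelope [CompleteSpace E] (hρ : 0 < ρ) (hφ : WeaklyConvex ρ φ)
    (hex : ∀ x, ∃ p, IsProx ρ φ x p) : Differentiable ℝ (moreauEnvelope (1 / (2 * ρ)) φ) := by
  intro x
  obtain ⟨p, hp⟩ := hex x
  exact (hasGradientAt_moreauEnvelope hρ hφ hex hp).differentiableAt

theorem stationarity_eq [CompleteSpace E] (hρ : 0 < ρ) (hφ : WeaklyConvex ρ φ)
    (hex : ∀ x, ∃ p, IsProx ρ φ x p) {x p : E} (hp : IsProx ρ φ x p) :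
    stationarity ρ φ x = 2 * ρ * ‖p - x‖ := by
  rw [stationarity, (hasGradientAt_moreauEnvelope hρ hφ hex hp).gradient, norm_smul,
    Real.norm_of_nonneg (by positivity), norm_sub_rev]

theorem abs_moreauEnvelope_sub_le (hρ : 0 < ρ) {L : ℝ} (hL : ∀ x x', |φ x - φ x'| ≤ L * ‖x - x'‖)
    (hex : ∀ x, ∃ p, IsProx ρ φ x p) (x x' : E) :
    |moreauEnvelope (1 / (2 * ρ)) φ x - moreauEnvelope (1 / (2 * ρ)) φ x'| ≤ L * ‖x - x'‖ := by
  have key : ∀ x x', moreauEnvelope (1 / (2 * ρ)) φ x - moreauEnvelope (1 / (2 * ρ)) φ x' ≤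
      L * ‖x - x'‖ := by
    intro x x'
    obtain ⟨p, hp⟩ := hex x
    obtain ⟨p', hp'⟩ := hex x'
    -- Translating the minimizer at `x'` leaves the quadratic term unchanged, so only the Lipschitz
    -- constant of `φ` enters.
    have h1 := moreauEnvelope_le hp hρ (p' + (x - x'))
    have h2 := (abs_le.1 (hL (p' + (x - x')) p')).2
    rw [hp'.moreauEnvelope_eq hρ]
    rw [add_sub_cancel_left] at h2
    rw [show p' + (x - x') - x = p' - x' by abel] at h1
    linarith
  refine abs_le.2 ⟨?_, key x x'⟩
  have := key x' x
  rw [norm_sub_rev] at this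
  linarith

theorem stationarity_le [CompleteSpace E] (hρ : 0 < ρ) {L : ℝ} (hL0 : 0 ≤ L)
    (hL : ∀ x x', |φ x - φ x'| ≤ L * ‖x - x'‖)
    (hex : ∀ x, ∃ p, IsProx ρ φ x p) (x : E) : stationarity ρ φ x ≤ L := by
  rw [stationarity, gradient, LinearIsometryEquiv.norm_map]
  refine norm_fderiv_le_of_lip' ℝ hL0 (Filter.Eventually.of_forall fun y => ?_)
  exact abs_moreauEnvelope_sub_le hρ hL hex y x

theorem stationarity_sq_le [CompleteSpace E] (hρ : 0 < ρ) (hφ : WeaklyConvex ρ φ)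
    (hex : ∀ x, ∃ p, IsProx ρ φ x p) (hb : BddBelow (Set.range φ)) (x : E) :
    stationarity ρ φ x ^ 2 ≤ 4 * ρ * (moreauEnvelope (1 / (2 * ρ)) φ x - ⨅ w, φ w) := by
  obtain ⟨p, hp⟩ := hex x
  rw [stationarity_eq hρ hφ hex hp, hp.moreauEnvelope_eq hρ]
  have := mul_nonneg hρ.le (sub_nonneg.2 (ciInf_le hb p))
  nlinarith

theorem moreauEnvelope_le_self (hρ : 0 < ρ) (hex : ∀ x, ∃ p, IsProx ρ φ x p) (x : E) :
    moreauEnvelope (1 / (2 * ρ)) φ x ≤ φ x := by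
  obtain ⟨p, hp⟩ := hex x
  simpa using moreauEnvelope_le hp hρ x

theorem iInf_le_moreauEnvelope (hρ : 0 < ρ) (hex : ∀ x, ∃ p, IsProx ρ φ x p)
    (hb : BddBelow (Set.range φ)) (x : E) : ⨅ w, φ w ≤ moreauEnvelope (1 / (2 * ρ)) φ x := by
  obtain ⟨p, hp⟩ := hex x
  rw [hp.moreauEnvelope_eq hρ]
  have := ciInf_le hb p
  have := mul_nonneg hρ.le (sq_nonneg ‖p - x‖)
  linarith

/-- The descent of the Moreau envelope along a step `x - η g`, up to the gap `φ x - δ`. -/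
theorem moreauEnvelope_step_le (hρ : 0 < ρ)
    (hex : ∀ x, ∃ p, IsProx ρ φ x p) {x p : E} (hp : IsProx ρ φ x p) (η : ℝ) (g : E) :
    moreauEnvelope (1 / (2 * ρ)) φ (x - η • g) ≤ moreauEnvelope (1 / (2 * ρ)) φ x +
      2 * ρ * η * inner ℝ g (p - x) + ρ * η ^ 2 * ‖g‖ ^ 2 := by
  obtain ⟨p', hp'⟩ := hex (x - η • g)
  have h1 := moreauEnvelope_le hp' hρ p
  rw [show p - (x - η • g) = (p - x) + η • g by abel, norm_add_sq_real, real_inner_smul_right,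
    norm_smul, mul_pow, Real.norm_eq_abs, sq_abs, real_inner_comm] at h1
  rw [hp.moreauEnvelope_eq hρ]
  linarith

/-- Minimality against `w = x` gives a decrease `ρ ‖p - x‖²`; half of it pays for the weak convexity
error, and the other half is the squared gradient norm over `8ρ`. -/
theorem IsProx.sub_add_le [CompleteSpace E] (hρ : 0 < ρ) (hφ : WeaklyConvex ρ φ)
    (hex : ∀ x, ∃ p, IsProx ρ φ x p) {x p : E} (hp : IsProx ρ φ x p) :
    φ p - φ x + ρ / 2 * ‖p - x‖ ^ 2 ≤ -(stationarity ρ φ x ^ 2) / (8 * ρ) := by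
  have h1 := hp x
  rw [sub_self, norm_zero] at h1
  rw [stationarity_eq hρ hφ hex hp, le_div_iff₀ (by positivity)]
  nlinarith

end Geometry

/-! ### The primal function -/

namespace Assumptions

variable {E F : Type*} [NormedAddCommGroup E] [InnerProductSpace ℝ E]
  [NormedAddCommGroup F] [InnerProductSpace ℝ F]
  {f : E → F → ℝ} {U Y : Set F} {L ρ μ : ℝ}

theorem abs_sub_le_left (h : Assumptions f U Y L ρ μ) (x x' : E) {y : F} (hy : y ∈ U) :
    |f x y - f x' y| ≤ L * ‖x - x'‖ := by
  simpa [Real.sqrt_sq (norm_nonneg _)] using h.lipschitz x x' y hy y hy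

theorem abs_sub_le_right (h : Assumptions f U Y L ρ μ) (x : E) {y y' : F} (hy : y ∈ U)
    (hy' : y' ∈ U) : |f x y - f x y'| ≤ L * ‖y - y'‖ := by
  simpa [Real.sqrt_sq (norm_nonneg _)] using h.lipschitz x x y hy y' hy'

theorem bddAbove_image (h : Assumptions f U Y L ρ μ) (x : E) : BddAbove (f x '' Y) := by
  obtain ⟨y₀, hy₀⟩ := h.nonempty
  obtain ⟨C, hC⟩ := Metric.isBounded_iff.1 h.bounded
  refine ⟨f x y₀ + L * C, ?_⟩
  rintro _ ⟨y, hy, rfl⟩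
  have h1 := (abs_le.1 (h.abs_sub_le_right x (h.subset hy) (h.subset hy₀))).2
  have h2 := mul_le_mul_of_nonneg_left (hC hy hy₀) h.L_pos.le
  rw [dist_eq_norm] at h2
  linarith

theorem le_Phi (h : Assumptions f U Y L ρ μ) (x : E) {y : F} (hy : y ∈ Y) : f x y ≤ Phi f Y x :=
  le_csSup (h.bddAbove_image x) ⟨y, hy, rfl⟩

theorem Phi_le (h : Assumptions f U Y L ρ μ) {x : E} {c : ℝ} (hc : ∀ y ∈ Y, f x y ≤ c) :
    Phi f Y x ≤ c :=
  csSup_le (h.nonempty.image _) (Set.forall_mem_image.2 hc)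

theorem abs_Phi_sub_le (h : Assumptions f U Y L ρ μ) (x x' : E) :
    |Phi f Y x - Phi f Y x'| ≤ L * ‖x - x'‖ := by
  have key : ∀ x x', Phi f Y x ≤ Phi f Y x' + L * ‖x - x'‖ := fun x x' => h.Phi_le fun y hy => by
    have h1 := (abs_le.1 (h.abs_sub_le_left x x' (h.subset hy))).2
    have h2 := h.le_Phi x' hy
    linarith
  have h1 := key x x'
  have h2 := key x' x
  rw [norm_sub_rev] at h2
  exact abs_le.2 ⟨by linarith, by linarith⟩

theorem weaklyConvex_Phi (h : Assumptions f U Y L ρ μ) : WeaklyConvex ρ (Phi f Y) := by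
  refine ⟨convex_univ, fun p _ w _ a b ha hb hab => ?_⟩
  have key : Phi f Y (a • p + b • w) ≤ a • (Phi f Y p + ρ / 2 * ‖p‖ ^ 2) +
      b • (Phi f Y w + ρ / 2 * ‖w‖ ^ 2) - ρ / 2 * ‖a • p + b • w‖ ^ 2 := by
    refine h.Phi_le fun y hy => ?_
    have h1 := (h.weaklyConvex y hy).2 (Set.mem_univ p) (Set.mem_univ w) ha hb hab
    simp only [smul_eq_mul] at h1 ⊢
    have h2 := mul_le_mul_of_nonneg_left (h.le_Phi p hy) ha
    have h3 := mul_le_mul_of_nonneg_left (h.le_Phi w hy) hb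
    linarith
  linarith

theorem lipschitzWith_Phi (h : Assumptions f U Y L ρ μ) :
    LipschitzWith L.toNNReal (Phi f Y) :=
  LipschitzWith.of_dist_le' fun x x' => by
    rw [Real.dist_eq, dist_eq_norm]; exact h.abs_Phi_sub_le x x'

theorem exists_isProx_Phi [ProperSpace E] (h : Assumptions f U Y L ρ μ)
    (hb : BddBelow (Set.range (Phi f Y))) (x : E) : ∃ p, IsProx ρ (Phi f Y) x p :=
  exists_isProx h.rho_pos h.lipschitzWith_Phi.continuous hb x

theorem exists_eq_Phi [ProperSpace F] (h : Assumptions f U Y L ρ μ) (x : E) :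
    ∃ y ∈ Y, f x y = Phi f Y x := by
  have hc : ContinuousOn (f x) Y :=
    (LipschitzOnWith.of_dist_le' fun y hy y' hy' => by
      rw [Real.dist_eq, dist_eq_norm]
      exact h.abs_sub_le_right x (h.subset hy) (h.subset hy')).continuousOn
  obtain ⟨y, hy, hmax⟩ :=
    (Metric.isCompact_of_isClosed_isBounded h.isClosed h.bounded).exists_isMaxOn h.nonempty hc
  exact ⟨y, hy, le_antisymm (h.le_Phi x hy) (h.Phi_le hmax)⟩

/-- Quadratic growth at a maximizer. -/
theorem add_norm_sq_le_Phi (h : Assumptions f U Y L ρ μ) {x : E} {y u : F} (hu : u ∈ Y)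
    (hmax : f x u = Phi f Y x) (hy : y ∈ Y) :
    f x y + μ / 2 * ‖u - y‖ ^ 2 ≤ Phi f Y x := by
  refine le_of_forall_pos_lt_one_le_add_mul (k := μ / 2 * ‖u - y‖ ^ 2) fun a ha ha1 => ?_
  have h1 := (h.stronglyConcave x).2 hu hy (by linarith : (0 : ℝ) ≤ 1 - a) ha.le (by ring)
  have h2 := h.le_Phi x (h.convex hu hy (by linarith : (0 : ℝ) ≤ 1 - a) ha.le (by ring))
  simp only [smul_eq_mul] at h1
  refine le_of_mul_le_mul_left ?_ ha
  rw [← hmax] at h2 ⊢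
  nlinarith

/-- Quadratic growth and the Lipschitz bounds in `x` make the maximizer 1/2-Hölder. Only its
continuity is used, for measurability of the comparison points. -/
theorem exists_continuous_maximizer [ProperSpace F] (h : Assumptions f U Y L ρ μ) :
    ∃ u : E → F, Continuous u ∧ ∀ x, u x ∈ Y ∧ f x (u x) = Phi f Y x := by
  choose u hu hmax using h.exists_eq_Phi
  refine ⟨u, ?_, fun x => ⟨hu x, hmax x⟩⟩
  rw [continuous_iff_continuousAt]
  intro x
  have hμ := h.mu_pos
  have key : ∀ x', dist (u x') (u x) ≤ √(4 * L / μ * ‖x' - x‖) := by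
    intro x'
    refine Real.le_sqrt_of_sq_le ?_
    have h1 := h.add_norm_sq_le_Phi (hu x') (hmax x') (hu x)
    have h2 := (abs_le.1 (h.abs_sub_le_left x' x (h.subset (hu x)))).1
    have h3 := (abs_le.1 (h.abs_Phi_sub_le x' x)).2
    rw [hmax] at h2
    rw [dist_eq_norm, div_mul_eq_mul_div, le_div_iff₀ hμ]
    linarith
  rw [ContinuousAt, tendsto_iff_dist_tendsto_zero]
  refine squeeze_zero (fun _ => dist_nonneg) key ?_
  have hcont : Continuous fun x' => √(4 * L / μ * ‖x' - x‖) := by fun_prop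
  simpa using hcont.tendsto x

theorem norm_le_of_mem_weakSubdifferential (h : Assumptions f U Y L ρ μ) {x g : E} {y : F}
    (hy : y ∈ Y) (hg : g ∈ weakSubdifferential ρ (fun x' => f x' y) x) : ‖g‖ ≤ L := by
  rcases (norm_nonneg g).eq_or_lt with h0 | h0
  · rw [← h0]; exact h.L_pos.le
  refine le_of_forall_pos_lt_one_le_add_mul (k := ρ / 2 * ‖g‖) fun a ha ha1 => ?_
  have h1 : (fun w => f w y + ρ / 2 * ‖w‖ ^ 2) x + inner ℝ (g + ρ • x) (x + a • g - x) ≤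
    f (x + a • g) y + ρ / 2 * ‖x + a • g‖ ^ 2 := hg (x + a • g)
  have h2 := (abs_le.1 (h.abs_sub_le_left (x + a • g) x (h.subset hy))).2
  rw [add_sub_cancel_left, norm_smul, Real.norm_of_nonneg ha.le] at h2
  rw [add_sub_cancel_left, norm_add_sq_real, inner_add_left, real_inner_smul_left,
    real_inner_smul_right, real_inner_smul_right, real_inner_self_eq_norm_sq, norm_smul,
    Real.norm_of_nonneg ha.le] at h1
  have h3 : (a * ‖g‖) * ‖g‖ ≤ (a * ‖g‖) * (L + a * (ρ / 2 * ‖g‖)) := by nlinarith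
  exact le_of_mul_le_mul_left h3 (by positivity)

theorem norm_le_of_mem_superdifferentialOn (h : Assumptions f U Y L ρ μ) {x : E} {y g : F}
    (hy : y ∈ Y) (hg : g ∈ superdifferentialOn U (f x) y) : ‖g‖ ≤ L := by
  rcases (norm_nonneg g).eq_or_lt with h0 | h0
  · rw [← h0]; exact h.L_pos.le
  -- Openness of `U` matters here: the test point `y - a g` may leave `Y`, but it stays in `U` for
  -- small `a`.
  have hcont : Continuous fun a : ℝ => y - a • g := by fun_prop
  have hev : ∀ᶠ a : ℝ in nhds 0, y - a • g ∈ U :=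
    hcont.continuousAt.eventually_mem (by simpa using h.isOpen_U.mem_nhds (h.subset hy))
  obtain ⟨a, haU, ha⟩ := ((hev.filter_mono nhdsWithin_le_nhds).and
    (self_mem_nhdsWithin (s := Set.Ioi (0 : ℝ)))).exists
  have ha : 0 < a := ha
  have h1 := hg _ haU
  have h2 := (abs_le.1 (h.abs_sub_le_right x haU (h.subset hy))).1
  rw [show y - a • g - y = -(a • g) by abel, norm_neg, norm_smul, Real.norm_of_nonneg ha.le] at h2
  rw [show y - a • g - y = -(a • g) by abel, inner_neg_right, real_inner_smul_right,
    real_inner_self_eq_norm_sq] at h1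
  have h3 : (a * ‖g‖) * ‖g‖ ≤ (a * ‖g‖) * L := by nlinarith
  exact le_of_mul_le_mul_left h3 (by positivity)

theorem inner_le_of_mem_weakSubdifferential {x g : E} {φ : E → ℝ}
    (hg : g ∈ weakSubdifferential ρ φ x) (w : E) :
    inner ℝ g (w - x) ≤ φ w - φ x + ρ / 2 * ‖w - x‖ ^ 2 := by
  have h1 : φ x + ρ / 2 * ‖x‖ ^ 2 + inner ℝ (g + ρ • x) (w - x) ≤ φ w + ρ / 2 * ‖w‖ ^ 2 := hg w
  rw [inner_add_left, real_inner_smul_left, inner_sub_right x, real_inner_self_eq_norm_sq] at h1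
  rw [norm_sub_sq_real, real_inner_comm x w]
  linarith

/-- The supergradient inequality is applied near `y` on the segment to `u`, where strong concavity
on `Y` adds the quadratic term; then `a → 0`. -/
theorem le_inner_of_mem_superdifferentialOn (h : Assumptions f U Y L ρ μ) {x : E} {y g u : F}
    (hy : y ∈ Y) (hg : g ∈ superdifferentialOn U (f x) y) (hu : u ∈ Y) :
    f x u - f x y + μ / 2 * ‖u - y‖ ^ 2 ≤ inner ℝ g (u - y) := by
  refine le_of_forall_pos_lt_one_le_add_mul (k := μ / 2 * ‖u - y‖ ^ 2) fun a ha ha1 => ?_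
  have h1 := (h.stronglyConcave x).2 hy hu (by linarith : (0 : ℝ) ≤ 1 - a) ha.le (by ring)
  have h2 := hg _ (h.subset (h.convex hy hu (by linarith : (0 : ℝ) ≤ 1 - a) ha.le (by ring)))
  rw [show (1 - a) • y + a • u - y = a • (u - y) by module, real_inner_smul_right] at h2
  simp only [smul_eq_mul] at h1
  rw [norm_sub_rev y u] at h1
  refine le_of_mul_le_mul_left ?_ ha
  nlinarith

end Assumptions

/-! ### The expected behaviour of the iterates -/

section Iterates

variable {E F Ω : Type*} [NormedAddCommGroup E] [InnerProductSpace ℝ E] [ProperSpace E]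
  [MeasurableSpace E] [BorelSpace E]
  [NormedAddCommGroup F] [InnerProductSpace ℝ F] [ProperSpace F]
  [MeasurableSpace F] [BorelSpace F] [MeasurableSpace Ω]

/-- Random iterates `(X t, V t)` with random directions `(A t, D t)` that satisfy the subgradient
inequalities in mean, against test points that are functions of the past iterates `X s`. -/
structure IsMeanSubgradientProcess (f : E → F → ℝ) (Y : Set F) (ρ μ S η : ℝ) (ηy : ℕ → ℝ)
    (P : Measure Ω) (x₀ : E) (X : ℕ → Ω → E) (V : ℕ → Ω → F) (A : ℕ → Ω → E) (D : ℕ → Ω → F) :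
    Prop where
  measurable_X : ∀ t, Measurable (X t)
  measurable_V : ∀ t, Measurable (V t)
  memLp_A : ∀ t, MemLp (A t) 2 P
  memLp_D : ∀ t, MemLp (D t) 2 P
  integral_A_le : ∀ t, ∫ ω, ‖A t ω‖ ^ 2 ∂P ≤ S
  integral_D_le : ∀ t, ∫ ω, ‖D t ω‖ ^ 2 ∂P ≤ S
  x_zero : ∀ ω, X 0 ω = x₀
  V_mem : ∀ t ω, V t ω ∈ Y
  x_step : ∀ t ω, X (t + 1) ω = X t ω - η • A t ω
  y_step : ∀ t ω, IsProjection Y (V t ω + ηy (t + 1) • D t ω) (V (t + 1) ω)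
  mean_x : ∀ t (q : E → E), Continuous q → (∃ c, ∀ x, ‖q x - x‖ ≤ c) →
    ∫ ω, inner ℝ (A t ω) (q (X t ω) - X t ω) ∂P ≤
      ∫ ω, (f (q (X t ω)) (V t ω) - f (X t ω) (V t ω) + ρ / 2 * ‖q (X t ω) - X t ω‖ ^ 2) ∂P
  mean_y : ∀ s t, s ≤ t → ∀ u : E → F, Continuous u → (∀ x, u x ∈ Y) →
    ∫ ω, (f (X t ω) (u (X s ω)) - f (X t ω) (V t ω) + μ / 2 * ‖u (X s ω) - V t ω‖ ^ 2) ∂P ≤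
      ∫ ω, inner ℝ (D t ω) (u (X s ω) - V t ω) ∂P

variable {f : E → F → ℝ} {U Y : Set F} {L ρ μ S η : ℝ} {ηy : ℕ → ℝ} {P : Measure Ω}
  {x₀ : E} {X : ℕ → Ω → E} {V : ℕ → Ω → F} {A : ℕ → Ω → E} {D : ℕ → Ω → F}

theorem Assumptions.measurable_comp (h : Assumptions f U Y L ρ μ) {Ω : Type*} [MeasurableSpace Ω]
    {a : Ω → E} {b : Ω → F}
    (ha : Measurable a) (hb : Measurable b) (hbY : ∀ ω, b ω ∈ Y) :
    Measurable fun ω => f (a ω) (b ω) := by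
  have hL := h.L_pos
  -- Nothing is known about `f` outside `U`, so joint continuity is proved on the subtype of `Y`.
  have hc : Continuous fun p : E × Y => f p.1 p.2 := by
    have : LipschitzWith (L + L).toNNReal fun p : E × Y => f p.1 p.2 := by
      refine LipschitzWith.of_dist_le' fun p q => ?_
      have h1 := h.abs_sub_le_left p.1 q.1 (h.subset p.2.2)
      have h2 := h.abs_sub_le_right q.1 (h.subset p.2.2) (h.subset q.2.2)
      have h3 : ‖p.1 - q.1‖ ≤ dist p q := by
        rw [← dist_eq_norm]; exact le_max_left _ _
      have h4 : ‖(p.2 : F) - q.2‖ ≤ dist p q := by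
        rw [← dist_eq_norm]; exact le_max_right _ _
      rw [Real.dist_eq]
      calc _ ≤ _ := abs_sub_le _ (f q.1 p.2) _
        _ ≤ _ := add_le_add h1 h2
        _ ≤ _ := by rw [add_mul]; gcongr
    exact this.continuous
  exact hc.measurable.comp (ha.prodMk (hb.subtype_mk (h := hbY)))

theorem Assumptions.exists_norm_sub_le (h : Assumptions f U Y L ρ μ) :
    ∃ c, ∀ y ∈ Y, ∀ y' ∈ Y, ‖y - y'‖ ≤ c := by
  obtain ⟨c, hc⟩ := Metric.isBounded_iff.1 h.bounded
  exact ⟨c, fun y hy y' hy' => by rw [← dist_eq_norm]; exact hc hy hy'⟩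

theorem integrable_of_abs_le [IsFiniteMeasure P] {φ : Ω → ℝ} (hm : Measurable φ) {c : ℝ}
    (hc : ∀ ω, |φ ω| ≤ c) : Integrable φ P :=
  (integrable_const c).mono' hm.aestronglyMeasurable (Filter.Eventually.of_forall hc)

theorem integrable_inner_of_bounded {G : Type*} [NormedAddCommGroup G] [InnerProductSpace ℝ G]
    {a b : Ω → G} (ha : Integrable a P)
    (hb : AEStronglyMeasurable b P) {c : ℝ} (hc : ∀ ω, ‖b ω‖ ≤ c) :
    Integrable (fun ω => inner ℝ (a ω) (b ω)) P := by
  refine (ha.norm.mul_const c).mono' (ha.1.inner hb) (Filter.Eventually.of_forall fun ω => ?_)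
  exact (norm_inner_le_norm _ _).trans (mul_le_mul_of_nonneg_left (hc ω) (norm_nonneg _))

namespace IsMeanSubgradientProcess

variable [IsProbabilityMeasure P]

theorem integrable_norm_A_sq (hp : IsMeanSubgradientProcess f Y ρ μ S η ηy P x₀ X V A D) (t : ℕ) :
    Integrable (fun ω => ‖A t ω‖ ^ 2) P := by
  simpa using (hp.memLp_A t).integrable_norm_pow two_ne_zero

theorem integrable_norm_D_sq (hp : IsMeanSubgradientProcess f Y ρ μ S η ηy P x₀ X V A D) (t : ℕ) :
    Integrable (fun ω => ‖D t ω‖ ^ 2) P := by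
  simpa using (hp.memLp_D t).integrable_norm_pow two_ne_zero

theorem integrable_A (hp : IsMeanSubgradientProcess f Y ρ μ S η ηy P x₀ X V A D) (t : ℕ) :
    Integrable (A t) P := (hp.memLp_A t).integrable one_le_two

theorem integrable_D (hp : IsMeanSubgradientProcess f Y ρ μ S η ηy P x₀ X V A D) (t : ℕ) :
    Integrable (D t) P := (hp.memLp_D t).integrable one_le_two

theorem integrable_X (hp : IsMeanSubgradientProcess f Y ρ μ S η ηy P x₀ X V A D) (t : ℕ) :
    Integrable (X t) P := by
  induction t with
  | zero => rw [funext hp.x_zero]; exact integrable_const _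
  | succ t ih => rw [funext (hp.x_step t)]; exact ih.sub ((hp.integrable_A t).smul η)

/-- Each step moves `x` by `η ‖A‖`, and `L ‖A‖ ≤ (L² + ‖A‖²) / 2` has mean at most `S`. -/
theorem integral_norm_sub_le (hp : IsMeanSubgradientProcess f Y ρ μ S η ηy P x₀ X V A D)
    (hL : 0 ≤ L) (hη : 0 ≤ η) (hS : L ^ 2 ≤ S) (s i : ℕ) :
    ∫ ω, L * ‖X (s + i) ω - X s ω‖ ∂P ≤ η * S * i := by
  induction i with
  | zero => simp
  | succ i ih =>
    have hi := hp.integrable_A (s + i)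
    have hX : ∀ j, Integrable (fun ω => L * ‖X (s + j) ω - X s ω‖) P := fun j =>
      ((hp.integrable_X _).sub (hp.integrable_X _)).norm.const_mul L
    have h1 : ∫ ω, L * ‖A (s + i) ω‖ ∂P ≤ S := by
      have h2 : ∫ ω, L * ‖A (s + i) ω‖ ∂P ≤ ∫ ω, (L ^ 2 / 2 + ‖A (s + i) ω‖ ^ 2 / 2) ∂P := by
        refine integral_mono (hi.norm.const_mul L)
          ((integrable_const _).add ((hp.integrable_norm_A_sq _).div_const 2)) fun ω => ?_
        have := sq_nonneg (L - ‖A (s + i) ω‖)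
        simp only
        linarith
      rw [integral_add (integrable_const _) ((hp.integrable_norm_A_sq _).div_const 2),
        integral_const, integral_div, probReal_univ, one_smul] at h2
      linarith [hp.integral_A_le (s + i)]
    have h3 : ∫ ω, L * ‖X (s + (i + 1)) ω - X s ω‖ ∂P ≤
        ∫ ω, (L * ‖X (s + i) ω - X s ω‖ + η * (L * ‖A (s + i) ω‖)) ∂P := by
      refine integral_mono (hX (i + 1)) ((hX i).add ((hi.norm.const_mul L).const_mul η)) fun ω => ?_
      simp only
      rw [← add_assoc, hp.x_step, sub_right_comm]
      have := norm_sub_le (X (s + i) ω - X s ω) (η • A (s + i) ω)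
      rw [norm_smul, Real.norm_of_nonneg hη] at this
      nlinarith [mul_le_mul_of_nonneg_left this hL]
    rw [integral_add (hX i) ((hi.norm.const_mul L).const_mul η), integral_const_mul η] at h3
    have h4 := mul_le_mul_of_nonneg_left h1 hη
    push_cast
    linarith

theorem integrable_moreauEnvelope (hp : IsMeanSubgradientProcess f Y ρ μ S η ηy P x₀ X V A D)
    (h : Assumptions f U Y L ρ μ) (hb : BddBelow (Set.range (Phi f Y))) (t : ℕ) :
    Integrable (fun ω => moreauEnvelope (1 / (2 * ρ)) (Phi f Y) (X t ω)) P := by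
  have hc := abs_moreauEnvelope_sub_le h.rho_pos h.abs_Phi_sub_le (h.exists_isProx_Phi hb)
  have hcont : Continuous (moreauEnvelope (1 / (2 * ρ)) (Phi f Y)) :=
    (differentiable_moreauEnvelope h.rho_pos h.weaklyConvex_Phi (h.exists_isProx_Phi hb)).continuous
  have hdom : Integrable (fun ω => |moreauEnvelope (1 / (2 * ρ)) (Phi f Y) x₀| +
      L * ‖X t ω - x₀‖) P :=
    (integrable_const _).add (((hp.integrable_X t).sub (integrable_const _)).norm.const_mul L)
  refine hdom.mono' (hcont.measurable.comp (hp.measurable_X t)).aestronglyMeasurable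
    (Filter.Eventually.of_forall fun ω => ?_)
  have h1 := hc (X t ω) x₀
  have h2 := abs_add_le (moreauEnvelope (1 / (2 * ρ)) (Phi f Y) (X t ω) -
    moreauEnvelope (1 / (2 * ρ)) (Phi f Y) x₀) (moreauEnvelope (1 / (2 * ρ)) (Phi f Y) x₀)
  rw [sub_add_cancel] at h2
  rw [Real.norm_eq_abs]
  linarith

theorem integrable_stationarity_sq (hp : IsMeanSubgradientProcess f Y ρ μ S η ηy P x₀ X V A D)
    (h : Assumptions f U Y L ρ μ) (hb : BddBelow (Set.range (Phi f Y))) (t : ℕ) :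
    Integrable (fun ω => stationarity ρ (Phi f Y) (X t ω) ^ 2) P := by
  have hm : Measurable (stationarity ρ (Phi f Y)) := by
    have : stationarity ρ (Phi f Y) =
        fun x => ‖fderiv ℝ (moreauEnvelope (1 / (2 * ρ)) (Phi f Y)) x‖ := by
      funext x
      rw [stationarity, gradient, LinearIsometryEquiv.norm_map]
    rw [this]
    exact (measurable_fderiv ℝ _).norm
  refine integrable_of_abs_le (c := L ^ 2) ((hm.comp (hp.measurable_X t)).pow_const 2) fun ω => ?_
  rw [abs_of_nonneg (sq_nonneg _)]
  exact pow_le_pow_left₀ (norm_nonneg _) (stationarity_le h.rho_pos h.L_pos.le h.abs_Phi_sub_le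
    (h.exists_isProx_Phi hb) _) 2

theorem integral_stationarity_sq_le (hp : IsMeanSubgradientProcess f Y ρ μ S η ηy P x₀ X V A D)
    (h : Assumptions f U Y L ρ μ) (hb : BddBelow (Set.range (Phi f Y))) (t : ℕ) :
    ∫ ω, stationarity ρ (Phi f Y) (X t ω) ^ 2 ∂P ≤ L ^ 2 := by
  have := integral_mono (hp.integrable_stationarity_sq h hb t) (integrable_const (L ^ 2)) fun ω =>
    pow_le_pow_left₀ (norm_nonneg _) (stationarity_le h.rho_pos h.L_pos.le h.abs_Phi_sub_le
    (h.exists_isProx_Phi hb) (X t ω)) 2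
  simpa using this

theorem integral_stationarity_sq_le_mul
    (hp : IsMeanSubgradientProcess f Y ρ μ S η ηy P x₀ X V A D)
    (h : Assumptions f U Y L ρ μ) (hb : BddBelow (Set.range (Phi f Y))) (t : ℕ) :
    ∫ ω, stationarity ρ (Phi f Y) (X t ω) ^ 2 ∂P ≤
      4 * ρ * (∫ ω, moreauEnvelope (1 / (2 * ρ)) (Phi f Y) (X t ω) ∂P - ⨅ x, Phi f Y x) := by
  have hi := hp.integrable_moreauEnvelope h hb t
  have := integral_mono (hp.integrable_stationarity_sq h hb t)
    ((hi.sub (integrable_const (⨅ x, Phi f Y x))).const_mul (4 * ρ)) fun ω =>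
    stationarity_sq_le h.rho_pos h.weaklyConvex_Phi (h.exists_isProx_Phi hb) hb (X t ω)
  refine this.trans_eq ?_
  rw [integral_const_mul]
  simp only [Pi.sub_apply]
  rw [integral_sub hi (integrable_const _)]
  simp

theorem iInf_le_integral_moreauEnvelope
    (hp : IsMeanSubgradientProcess f Y ρ μ S η ηy P x₀ X V A D)
    (h : Assumptions f U Y L ρ μ) (hb : BddBelow (Set.range (Phi f Y))) (t : ℕ) :
    ⨅ x, Phi f Y x ≤ ∫ ω, moreauEnvelope (1 / (2 * ρ)) (Phi f Y) (X t ω) ∂P := by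
  have := integral_mono (integrable_const (⨅ x, Phi f Y x)) (hp.integrable_moreauEnvelope h hb t)
    fun ω => iInf_le_moreauEnvelope h.rho_pos (h.exists_isProx_Phi hb) hb (X t ω)
  simpa using this

theorem integral_moreauEnvelope_zero_le
    (hp : IsMeanSubgradientProcess f Y ρ μ S η ηy P x₀ X V A D)
    (h : Assumptions f U Y L ρ μ) (hb : BddBelow (Set.range (Phi f Y))) :
    ∫ ω, moreauEnvelope (1 / (2 * ρ)) (Phi f Y) (X 0 ω) ∂P ≤
      (⨅ x, Phi f Y x) + DeltaPhi f Y x₀ := by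
  simp only [hp.x_zero, integral_const, probReal_univ, one_smul, DeltaPhi, add_sub_cancel]
  exact moreauEnvelope_le_self h.rho_pos (h.exists_isProx_Phi hb) x₀

theorem integral_moreauEnvelope_le
    (hp : IsMeanSubgradientProcess f Y ρ μ S η ηy P x₀ X V A D)
    (h : Assumptions f U Y L ρ μ) (hb : BddBelow (Set.range (Phi f Y)))
    (hη : 0 ≤ η) (hS : L ^ 2 ≤ S) (t : ℕ) :
    ∫ ω, moreauEnvelope (1 / (2 * ρ)) (Phi f Y) (X t ω) ∂P ≤
      (⨅ x, Phi f Y x) + DeltaPhi f Y x₀ + η * S * t := by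
  have h1 := hp.integral_norm_sub_le h.L_pos.le hη hS 0 t
  rw [zero_add] at h1
  have hd : Integrable (fun ω => L * ‖X t ω - X 0 ω‖) P :=
    ((hp.integrable_X t).sub (hp.integrable_X 0)).norm.const_mul L
  have h2 := integral_mono (hp.integrable_moreauEnvelope h hb t)
    ((hp.integrable_moreauEnvelope h hb 0).add hd) fun ω => by
      have := (abs_le.1 (abs_moreauEnvelope_sub_le h.rho_pos h.abs_Phi_sub_le
        (h.exists_isProx_Phi hb) (X t ω) (X 0 ω))).2
      exact tsub_le_iff_left.1 this
  have h3 := hp.integral_moreauEnvelope_zero_le h hb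
  simp only [Pi.add_apply] at h2
  rw [integral_add (hp.integrable_moreauEnvelope h hb 0) hd] at h2
  linarith

theorem integrable_sub (hp : IsMeanSubgradientProcess f Y ρ μ S η ηy P x₀ X V A D)
    (h : Assumptions f U Y L ρ μ) {u : E → F} (hu : Continuous u) (huY : ∀ x, u x ∈ Y)
    (s t : ℕ) : Integrable (fun ω => f (X t ω) (u (X s ω)) - f (X t ω) (V t ω)) P := by
  obtain ⟨c, hc⟩ := h.exists_norm_sub_le
  have hm : Measurable fun ω => f (X t ω) (u (X s ω)) - f (X t ω) (V t ω) :=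
    (h.measurable_comp (hp.measurable_X t) (hu.measurable.comp (hp.measurable_X s))
      fun ω => huY _).sub (h.measurable_comp (hp.measurable_X t) (hp.measurable_V t) (hp.V_mem t))
  refine integrable_of_abs_le (c := L * c) hm fun ω => ?_
  exact (h.abs_sub_le_right _ (h.subset (huY _)) (h.subset (hp.V_mem t ω))).trans
    (mul_le_mul_of_nonneg_left (hc _ (huY _) _ (hp.V_mem t ω)) h.L_pos.le)

theorem integrable_norm_sub_sq (hp : IsMeanSubgradientProcess f Y ρ μ S η ηy P x₀ X V A D)
    (h : Assumptions f U Y L ρ μ) {u : E → F} (hu : Continuous u) (huY : ∀ x, u x ∈ Y)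
    (s t : ℕ) : Integrable (fun ω => ‖u (X s ω) - V t ω‖ ^ 2) P := by
  obtain ⟨c, hc⟩ := h.exists_norm_sub_le
  have hm : Measurable fun ω => ‖u (X s ω) - V t ω‖ ^ 2 :=
    ((hu.measurable.comp (hp.measurable_X s)).sub (hp.measurable_V t)).norm.pow_const 2
  refine integrable_of_abs_le (c := c ^ 2) hm fun ω => ?_
  rw [abs_of_nonneg (sq_nonneg _)]
  exact pow_le_pow_left₀ (norm_nonneg _) (hc _ (huY _) _ (hp.V_mem t ω)) 2

theorem integrable_gap (hp : IsMeanSubgradientProcess f Y ρ μ S η ηy P x₀ X V A D)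
    (h : Assumptions f U Y L ρ μ) (t : ℕ) :
    Integrable (fun ω => Phi f Y (X t ω) - f (X t ω) (V t ω)) P := by
  obtain ⟨u, hu, hmax⟩ := h.exists_continuous_maximizer
  simpa only [(hmax _).2] using hp.integrable_sub h hu (fun x => (hmax x).1) t t

/-- The expected descent of the Moreau envelope in one iteration. -/
theorem integral_moreauEnvelope_succ_le
    (hp : IsMeanSubgradientProcess f Y ρ μ S η ηy P x₀ X V A D)
    (h : Assumptions f U Y L ρ μ) (hb : BddBelow (Set.range (Phi f Y)))
    (hη : 0 ≤ η) (t : ℕ) :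
    ∫ ω, moreauEnvelope (1 / (2 * ρ)) (Phi f Y) (X (t + 1) ω) ∂P ≤
      ∫ ω, moreauEnvelope (1 / (2 * ρ)) (Phi f Y) (X t ω) ∂P
      + 2 * ρ * η * ∫ ω, (Phi f Y (X t ω) - f (X t ω) (V t ω)) ∂P
      - η / 4 * ∫ ω, stationarity ρ (Phi f Y) (X t ω) ^ 2 ∂P + ρ * η ^ 2 * S := by
  have hρ := h.rho_pos
  have hex := h.exists_isProx_Phi hb
  choose q hq using hex
  have hqc : Continuous q := by
    have : LipschitzWith (2 : ℝ).toNNReal q := LipschitzWith.of_dist_le' fun x x' => by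
      rw [dist_eq_norm, dist_eq_norm]
      exact IsProx.norm_sub_le hρ h.weaklyConvex_Phi (hq x') (hq x)
    exact this.continuous
  have hqb : ∀ x, ‖q x - x‖ ≤ L / (2 * ρ) := fun x => by
    rw [le_div_iff₀ (by positivity), mul_comm,
      ← stationarity_eq hρ h.weaklyConvex_Phi (h.exists_isProx_Phi hb) (hq x)]
    exact stationarity_le hρ h.L_pos.le h.abs_Phi_sub_le (h.exists_isProx_Phi hb) x
  have hqm : Measurable fun ω => q (X t ω) - X t ω :=
    (hqc.measurable.comp (hp.measurable_X t)).sub (hp.measurable_X t)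
  have hin : Integrable (fun ω => inner ℝ (A t ω) (q (X t ω) - X t ω)) P :=
    integrable_inner_of_bounded (hp.integrable_A t) hqm.aestronglyMeasurable fun ω => hqb _
  have h1 := hp.mean_x t q hqc ⟨_, hqb⟩
  have hI : Integrable (fun ω => f (q (X t ω)) (V t ω) - f (X t ω) (V t ω) +
      ρ / 2 * ‖q (X t ω) - X t ω‖ ^ 2) P := by
    refine Integrable.add ?_ (Integrable.const_mul ?_ _)
    · refine integrable_of_abs_le (c := L * (L / (2 * ρ))) ?_ fun ω => ?_
      · exact (h.measurable_comp (hqc.measurable.comp (hp.measurable_X t)) (hp.measurable_V t)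
          (hp.V_mem t)).sub (h.measurable_comp (hp.measurable_X t) (hp.measurable_V t) (hp.V_mem t))
      · exact (h.abs_sub_le_left _ _ (h.subset (hp.V_mem t ω))).trans
          (mul_le_mul_of_nonneg_left (hqb _) h.L_pos.le)
    · refine integrable_of_abs_le (c := (L / (2 * ρ)) ^ 2) (hqm.norm.pow_const 2) fun ω => ?_
      rw [abs_of_nonneg (sq_nonneg _)]
      exact pow_le_pow_left₀ (norm_nonneg _) (hqb _) 2
  have hs := hp.integrable_stationarity_sq h hb t
  have hg := hp.integrable_gap h t
  -- Replacing `f(q, V)` by the larger `Φ(q)` turns the subgradient bound into the gap plus the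
  -- proximal decrease.
  have h2 := integral_mono hI (hg.sub (hs.div_const (8 * ρ))) fun ω => by
    have h3 := h.le_Phi (q (X t ω)) (hp.V_mem t ω)
    have h4 := (hq (X t ω)).sub_add_le hρ h.weaklyConvex_Phi (h.exists_isProx_Phi hb)
    rw [neg_div] at h4
    simp only [Pi.sub_apply]
    linarith
  simp only [Pi.sub_apply] at h2
  rw [integral_sub hg (hs.div_const _), integral_div] at h2
  have he := hp.integrable_moreauEnvelope h hb
  have hA := hp.integrable_norm_A_sq t
  have hsum : Integrable (fun ω => moreauEnvelope (1 / (2 * ρ)) (Phi f Y) (X t ω) +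
      2 * ρ * η * inner ℝ (A t ω) (q (X t ω) - X t ω)) P := (he t).add (hin.const_mul (2 * ρ * η))
  have h5 := integral_mono (he (t + 1)) (hsum.add (hA.const_mul (ρ * η ^ 2))) fun ω => by
      simp only [Pi.add_apply]
      rw [hp.x_step]
      exact moreauEnvelope_step_le hρ (h.exists_isProx_Phi hb) (hq (X t ω)) η (A t ω)
  simp only [Pi.add_apply] at h5
  rw [integral_add hsum (hA.const_mul (ρ * η ^ 2)),
    integral_add (he t) (hin.const_mul (2 * ρ * η)), integral_const_mul, integral_const_mul] at h5
  have h6 := mul_le_mul_of_nonneg_left (h1.trans h2) (by positivity : 0 ≤ 2 * ρ * η)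
  have h7 := mul_le_mul_of_nonneg_left (hp.integral_A_le t) (by positivity : 0 ≤ ρ * η ^ 2)
  have h8 : 2 * ρ * η * ((∫ ω, stationarity ρ (Phi f Y) (X t ω) ^ 2 ∂P) / (8 * ρ)) =
      η / 4 * ∫ ω, stationarity ρ (Phi f Y) (X t ω) ^ 2 ∂P := by
    field_simp
    ring
  rw [mul_sub, h8] at h6
  linarith

/-- The expected gap in the iteration `s + i`, in terms of the distance to a maximizer at `X s`. -/
theorem integral_gap_le (hp : IsMeanSubgradientProcess f Y ρ μ S η ηy P x₀ X V A D)
    (h : Assumptions f U Y L ρ μ) (hη : 0 ≤ η) (hS : L ^ 2 ≤ S) (s i : ℕ)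
    (hηy : ηy (s + i + 1) = 1 / (μ * (i + 1))) {u : E → F} (hu : Continuous u)
    (hmax : ∀ x, u x ∈ Y ∧ f x (u x) = Phi f Y x) :
    ∫ ω, (Phi f Y (X (s + i) ω) - f (X (s + i) ω) (V (s + i) ω)) ∂P ≤
      2 * η * S * i + S / (2 * μ) * (1 / (i + 1)) +
      (μ / 2 * (i * ∫ ω, ‖u (X s ω) - V (s + i) ω‖ ^ 2 ∂P) -
        μ / 2 * ((i + 1) * ∫ ω, ‖u (X s ω) - V (s + i + 1) ω‖ ^ 2 ∂P)) := by
  have hμ := h.mu_pos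
  have huY := fun x => (hmax x).1
  obtain ⟨c, hc⟩ := h.exists_norm_sub_le
  have hsub := hp.integrable_sub h hu huY s (s + i)
  have hsq := hp.integrable_norm_sub_sq h hu huY s
  have hX : Integrable (fun ω => L * ‖X (s + i) ω - X s ω‖) P :=
    ((hp.integrable_X (s + i)).sub (hp.integrable_X s)).norm.const_mul L
  have hin : Integrable (fun ω => inner ℝ (D (s + i) ω) (u (X s ω) - V (s + i) ω)) P :=
    integrable_inner_of_bounded (hp.integrable_D _) ((hu.measurable.comp (hp.measurable_X s)).sub
      (hp.measurable_V _)).aestronglyMeasurable fun ω => hc _ (huY _) _ (hp.V_mem _ ω)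
  -- The drift is paid twice, once for `Φ` and once for `f(·, u)` at the frozen point `u = u(X s)`.
  have h1 := integral_mono (hp.integrable_gap h (s + i)) ((hX.const_mul 2).add hsub) fun ω => by
    have h2 := (abs_le.1 (h.abs_Phi_sub_le (X (s + i) ω) (X s ω))).2
    have h3 := (abs_le.1 (h.abs_sub_le_left (X (s + i) ω) (X s ω)
      (h.subset (huY (X s ω))))).1
    rw [(hmax (X s ω)).2] at h3
    simp only [Pi.add_apply]
    linarith
  simp only [Pi.add_apply] at h1
  rw [integral_add (hX.const_mul 2) hsub, integral_const_mul] at h1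
  have h4 := hp.integral_norm_sub_le h.L_pos.le hη hS s i
  have h5 := hp.mean_y s (s + i) (Nat.le_add_right _ _) u hu huY
  rw [integral_add hsub ((hsq _).const_mul _), integral_const_mul] at h5
  set ζ := ηy (s + i + 1) with hζ
  have hdiff : Integrable (fun ω => ‖u (X s ω) - V (s + i) ω‖ ^ 2 -
      2 * ζ * inner ℝ (D (s + i) ω) (u (X s ω) - V (s + i) ω)) P :=
    (hsq (s + i)).sub (hin.const_mul (2 * ζ))
  have h6 := integral_mono (hsq (s + i + 1)) (hdiff.add
      ((hp.integrable_norm_D_sq (s + i)).const_mul (ζ ^ 2))) fun ω => by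
    -- The point `u (X s)` lies in `Y`, hence is its own projection, and projections are
    -- nonexpansive.
    have h7 := (hp.y_step (s + i) ω).norm_sub_le_norm_sub h.convex
      (⟨huY (X s ω), fun _ _ => by simp⟩ : IsProjection Y (u (X s ω)) (u (X s ω)))
    rw [norm_sub_rev, norm_sub_rev _ (u _), ← hζ, ← sub_sub] at h7
    have h8 := pow_le_pow_left₀ (norm_nonneg _) h7 2
    rw [norm_sub_sq_real _ (ζ • _), real_inner_smul_right, norm_smul, mul_pow, Real.norm_eq_abs,
      sq_abs, real_inner_comm] at h8
    simp only [Pi.add_apply]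
    linarith
  simp only [Pi.add_apply] at h6
  rw [integral_add hdiff ((hp.integrable_norm_D_sq (s + i)).const_mul (ζ ^ 2)),
    integral_sub (hsq (s + i)) (hin.const_mul (2 * ζ)), integral_const_mul, integral_const_mul] at h6
  have h9 := hp.integral_D_le (s + i)
  have hζ0 : 0 < ζ := by rw [hηy]; positivity
  have h10 := mul_le_mul_of_nonneg_left h9 (sq_nonneg ζ)
  have h11 := mul_le_mul_of_nonneg_left h5 hζ0.le
  have hζi : ζ * (μ * (i + 1)) = 1 := by rw [hηy]; field_simp
  set w := ∫ ω, ‖u (X s ω) - V (s + i) ω‖ ^ 2 ∂P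
  set w' := ∫ ω, ‖u (X s ω) - V (s + i + 1) ω‖ ^ 2 ∂P
  set e := ∫ ω, (f (X (s + i) ω) (u (X s ω)) - f (X (s + i) ω) (V (s + i) ω)) ∂P
  have h12 : 2 * ζ * (e + μ / 2 * w) ≤ w - w' + ζ ^ 2 * S := by linarith
  -- Multiply by `1 / (2ζ) = μ (i + 1) / 2`. Moving the strong concavity term `μ / 2 * w` to the
  -- right lowers the weight of `w` from `i + 1` to `i`, so the distances telescope.
  have h13 : e + μ / 2 * w ≤ μ * (i + 1) / 2 * (w - w') + S / (2 * μ) * (1 / (i + 1)) := by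
    have hk : 0 < μ * (i + 1) / 2 := by positivity
    have h14 := mul_le_mul_of_nonneg_left h12 hk.le
    have h15 : μ * (i + 1) / 2 * (2 * ζ * (e + μ / 2 * w)) = e + μ / 2 * w := by
      linear_combination (e + μ / 2 * w) * hζi
    have h16 : μ * (i + 1) / 2 * (ζ ^ 2 * S) = S / (2 * μ) * (1 / (i + 1)) := by
      rw [hηy]; field_simp
    rw [h15, mul_add, h16] at h14
    exact h14
  linarith

/-- The expected gaps of the first `k` iterations of an epoch. -/
theorem sum_integral_gap_le (hp : IsMeanSubgradientProcess f Y ρ μ S η ηy P x₀ X V A D)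
    (h : Assumptions f U Y L ρ μ) (hη : 0 ≤ η) (hS : L ^ 2 ≤ S) (s k : ℕ)
    (hηy : ∀ i < k, ηy (s + i + 1) = 1 / (μ * (i + 1))) :
    ∑ i ∈ Finset.range k, ∫ ω, (Phi f Y (X (s + i) ω) - f (X (s + i) ω) (V (s + i) ω)) ∂P ≤
      η * S * k ^ 2 + S / (2 * μ) * (1 + Real.log k) := by
  obtain ⟨u, hu, hmax⟩ := h.exists_continuous_maximizer
  have hμ := h.mu_pos
  have hS0 : 0 ≤ S := (sq_nonneg L).trans hS
  -- At `j = 0` the distance has weight `0`: no bound on the starting point of the epoch is needed.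
  have key : ∀ j ≤ k,
      ∑ i ∈ Finset.range j, ∫ ω, (Phi f Y (X (s + i) ω) - f (X (s + i) ω) (V (s + i) ω)) ∂P ≤
      η * S * j ^ 2 + S / (2 * μ) * (harmonic j : ℝ) -
        μ / 2 * (j * ∫ ω, ‖u (X s ω) - V (s + j) ω‖ ^ 2 ∂P) := by
    intro j hj
    induction j with
    | zero => simp
    | succ j ih =>
      have h1 := ih (by omega)
      have h2 := hp.integral_gap_le h hη hS s j (hηy j hj) hu hmax
      rw [Finset.sum_range_succ, harmonic_succ]
      have h3 := mul_nonneg hη hS0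
      push_cast
      rw [← one_div ((j : ℝ) + 1), ← add_assoc s j 1]
      linarith
  have h1 := key k le_rfl
  have h2 : 0 ≤ μ / 2 * (k * ∫ ω, ‖u (X s ω) - V (s + k) ω‖ ^ 2 ∂P) := by
    have : 0 ≤ ∫ ω, ‖u (X s ω) - V (s + k) ω‖ ^ 2 ∂P := integral_nonneg fun ω => sq_nonneg _
    positivity
  have h3 := mul_le_mul_of_nonneg_left (harmonic_le_one_add_log k)
    (by positivity : 0 ≤ S / (2 * μ))
  linarith

end IsMeanSubgradientProcess

end Iterates

/-! ### The step size, the epoch length and the complexity bound -/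

/-- The last, possibly incomplete block still costs a full `c₂`, hence the count `n / B + 1`. -/
theorem sum_range_le_of_blocks {B : ℕ} (hB : 0 < B) {d : ℕ → ℝ} {c₁ c₂ : ℝ}
    (h : ∀ j k, k ≤ B → ∑ i ∈ Finset.range k, d (j * B + i) ≤ c₁ * k + c₂) (n : ℕ) :
    ∑ t ∈ Finset.range n, d t ≤ c₁ * n + ((n / B : ℕ) + 1) * c₂ := by
  have key : ∀ j : ℕ, ∑ t ∈ Finset.range (j * B), d t ≤ c₁ * (j * B : ℕ) + j * c₂ := by
    intro j
    induction j with
    | zero => simp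
    | succ j ih =>
      rw [Nat.succ_mul, Finset.sum_range_add]
      have := h j B le_rfl
      push_cast at ih ⊢
      linarith
  have h1 := key (n / B)
  have h2 := h (n / B) (n % B) (Nat.mod_lt n hB).le
  have h3 : n / B * B + n % B = n := Nat.div_add_mod' n B
  have h4 : ∑ t ∈ Finset.range (n / B * B + n % B), d t ≤
      c₁ * ((n / B * B + n % B : ℕ) : ℝ) + ((n / B : ℕ) + 1) * c₂ := by
    rw [Finset.sum_range_add]
    push_cast at h1 ⊢
    linarith
  rwa [h3] at h4

section StepSize

variable {ρ μ S ε : ℝ}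

theorem log_one_add_sq_pos {κ : ℝ} (hκ : 0 < κ) : 0 < Real.log (1 + 4096 * κ ^ 2) :=
  Real.log_pos (by nlinarith [pow_pos hκ 2])

theorem stepX_eq (hρ : 0 < ρ) (hμ : 0 < μ) (hS : 0 < S) (hε : 0 < ε) {κ : ℝ}
    (hκ : κ = ρ * S / (μ * ε ^ 2)) :
    stepX ρ μ S ε = min (1 / (48 * (μ * κ)))
      (min (1 / (4096 * (μ * κ ^ 2)))
        (1 / (4096 * (μ * κ ^ 2) * Real.log (1 + 4096 * κ ^ 2) ^ 2))) := by
  have hκ0 : 0 < κ := by rw [hκ]; positivity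
  have h1 : 4096 * ρ ^ 2 * S ^ 2 / (μ ^ 2 * ε ^ 4) = 4096 * κ ^ 2 := by
    rw [hκ]; field_simp
  have hl := log_one_add_sq_pos hκ0
  rw [stepX, h1]
  congr 1
  · rw [hκ]; field_simp
  · have h2 : μ * ε ^ 4 / (4096 * ρ ^ 2 * S ^ 2) = 1 / (4096 * (μ * κ ^ 2)) := by
      rw [hκ]; field_simp
    congr 1
    rw [← div_div, h2, div_div]

theorem stepX_pos (hρ : 0 < ρ) (hμ : 0 < μ) (hS : 0 < S) (hε : 0 < ε) : 0 < stepX ρ μ S ε := by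
  have hκ : 0 < ρ * S / (μ * ε ^ 2) := by positivity
  have hl := log_one_add_sq_pos hκ
  rw [stepX_eq hρ hμ hS hε rfl]
  positivity

theorem stepX_le (hρ : 0 < ρ) (hS : 0 < S) :
    48 * (ρ * S * stepX ρ μ S ε) ≤ ε ^ 2 := by
  have h : stepX ρ μ S ε ≤ ε ^ 2 / (48 * ρ * S) := min_le_left _ _
  rw [le_div_iff₀ (by positivity)] at h
  linarith

theorem sq_mul_stepX_le (hρ : 0 < ρ) (hμ : 0 < μ) (hS : 0 < S) (hε : 0 < ε) {κ : ℝ}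
    (hκ : κ = ρ * S / (μ * ε ^ 2)) :
    (64 * κ * max 1 (Real.log (1 + 4096 * κ ^ 2))) ^ 2 * (μ * stepX ρ μ S ε) ≤ 1 := by
  have hκ0 : 0 < κ := by rw [hκ]; positivity
  have hl := log_one_add_sq_pos hκ0
  have h := stepX_eq hρ hμ hS hε hκ
  have h1 : stepX ρ μ S ε ≤ 1 / (4096 * (μ * κ ^ 2)) :=
    h.trans_le ((min_le_right _ _).trans (min_le_left _ _))
  have h2 : stepX ρ μ S ε ≤ 1 / (4096 * (μ * κ ^ 2) * Real.log (1 + 4096 * κ ^ 2) ^ 2) :=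
    h.trans_le ((min_le_right _ _).trans (min_le_right _ _))
  rw [le_div_iff₀ (by positivity)] at h1 h2
  rcases max_choice 1 (Real.log (1 + 4096 * κ ^ 2)) with h3 | h3 <;> rw [h3] <;> linarith

theorem log_one_add_mul_sq_le {κ : ℝ} (hκ : 0 < κ) :
    Real.log (1 + 4096 * κ ^ 2) ^ 2 ≤ 162 + 2 * Real.log (1 + κ ^ 2) ^ 2 := by
  have h1 : Real.log (1 + 4096 * κ ^ 2) ≤ 9 + Real.log (1 + κ ^ 2) := by
    have h2 : Real.log 4096 ≤ 9 := by
      rw [show (4096 : ℝ) = 2 ^ 12 by norm_num, Real.log_pow]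
      have := Real.log_two_lt_d9
      push_cast
      linarith
    have h3 : Real.log (1 + 4096 * κ ^ 2) ≤ Real.log (4096 * (1 + κ ^ 2)) :=
      Real.log_le_log (by positivity) (by nlinarith)
    rw [Real.log_mul (by norm_num) (by positivity)] at h3
    linarith
  have h4 := pow_le_pow_left₀ (log_one_add_sq_pos hκ).le h1 2
  nlinarith [sq_nonneg (9 - Real.log (1 + κ ^ 2))]

/-- The constant is `671744 = 4096 * 164`, where `164 = 162 + 2` comes from removing the factor
`4096` inside the logarithm, with `log 4096 ≤ 9`. -/
theorem one_le_stepX_mul (hρ : 0 < ρ) (hμ : 0 < μ) (hS : 0 < S) (hε : 0 < ε) {κ M : ℝ}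
    (hκ : κ = ρ * S / (μ * ε ^ 2)) (hM : M = max 1 (max κ (κ * Real.log (1 + κ ^ 2) ^ 2))) :
    1 ≤ stepX ρ μ S ε * (671744 * (μ * κ) * M) := by
  have hκ0 : 0 < κ := by rw [hκ]; positivity
  have hl := log_one_add_sq_pos hκ0
  have hM1 : 1 ≤ M := hM ▸ le_max_left _ _
  have hM2 : κ ≤ M := hM ▸ (le_max_left _ _).trans (le_max_right _ _)
  have hM3 : κ * Real.log (1 + κ ^ 2) ^ 2 ≤ M := hM ▸ (le_max_right _ _).trans (le_max_right _ _)
  have h0 : 0 < μ * κ := by positivity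
  rw [← div_le_iff₀ (by positivity), stepX_eq hρ hμ hS hε hκ]
  refine le_min ?_ (le_min ?_ ?_) <;> refine one_div_le_one_div_of_le (by positivity) ?_
  · nlinarith
  · nlinarith
  · have h1 := mul_le_mul_of_nonneg_left (log_one_add_mul_sq_le hκ0) hκ0.le
    have h2 : κ * Real.log (1 + 4096 * κ ^ 2) ^ 2 ≤ 164 * M := by linarith
    have h3 := mul_le_mul_of_nonneg_left h2 h0.le
    linarith

theorem complexity_eq {Δ : ℝ} {κ M : ℝ}
    (hκ : κ = ρ * S / (μ * ε ^ 2)) (hM : M = max 1 (max κ (κ * Real.log (1 + κ ^ 2) ^ 2))) :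
    complexity ρ μ S Δ ε = ρ * S * Δ / ε ^ 4 * M := by
  have h1 : ρ ^ 2 * S ^ 2 / (μ ^ 2 * ε ^ 4) = κ ^ 2 := by rw [hκ]; ring
  rw [complexity, h1, ← hκ, ← hM]

/-- Put `b = 64 κ m`. If `b < 1`, then `κ ≤ 1/64` and `log B ≤ B - 1` suffice. Otherwise `log B ≤
log b + B / b - 1`, and `1 + log b ≤ 3m/2` because `64² = 4096` gives `log(64κ) ≤ m / 2`, while `log
m ≤ m - 1`. -/
theorem epochLength_mul_log_le {κ m B : ℝ} (hκ : 0 < κ)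
    (hm : m = max 1 (Real.log (1 + 4096 * κ ^ 2))) (hB1 : 1 ≤ B) (hB : 64 * κ * m ≤ B) :
    4 * κ * (1 + Real.log B) ≤ 3 / 32 * B := by
  have hm1 : 1 ≤ m := hm ▸ le_max_left _ _
  have hml : Real.log (1 + 4096 * κ ^ 2) ≤ m := hm ▸ le_max_right _ _
  have hB0 : 0 < B := by linarith
  rcases lt_or_ge (64 * κ * m) 1 with hb | hb
  · have h1 := Real.log_le_sub_one_of_pos hB0
    have h2 : κ ≤ 1 / 64 := by nlinarith
    have h3 : κ * (1 + Real.log B) ≤ κ * B := by gcongr; linarith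
    nlinarith
  · have hb0 : 0 < 64 * κ * m := by positivity
    have h1 := Real.log_le_sub_one_of_pos (div_pos hB0 hb0)
    rw [Real.log_div hB0.ne' hb0.ne'] at h1
    have h2 : 1 + Real.log (64 * κ * m) ≤ 3 / 2 * m := by
      rw [Real.log_mul (by positivity) (by positivity)]
      have h3 := Real.log_le_sub_one_of_pos (by linarith : 0 < m)
      have h4 : 2 * Real.log (64 * κ) ≤ Real.log (1 + 4096 * κ ^ 2) := by
        rw [← Nat.cast_two, ← Real.log_pow]
        exact Real.log_le_log (by positivity) (by nlinarith)
      linarith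
    have h5 : 64 * κ * m * (B / (64 * κ * m)) = B := mul_div_cancel₀ _ hb0.ne'
    have h6 : 64 * κ * m * (1 + Real.log B) ≤ 64 * κ * m * (Real.log (64 * κ * m) +
      B / (64 * κ * m)) := mul_le_mul_of_nonneg_left (by linarith) hb0.le
    have h7 : 64 * κ * m * Real.log (64 * κ * m) ≤ B * Real.log (64 * κ * m) :=
      mul_le_mul_of_nonneg_right hB (Real.log_nonneg hb)
    have h8 : B * (1 + Real.log (64 * κ * m)) ≤ B * (3 / 2 * m) := by gcongr
    have h9 : m * (4 * κ * (1 + Real.log B)) ≤ m * (3 / 32 * B) := by nlinarith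
    exact le_of_mul_le_mul_left h9 (by linarith)

end StepSize

/-- The convergence rate, deduced from the expected descent of the Moreau envelope `a`, the
expected gaps `d` within an epoch, and the a priori bounds on the stationarity measure `s`. -/
theorem average_le {ρ μ S L ε Δ I : ℝ} (hρ : 0 < ρ) (hμ : 0 < μ) (hL : 0 < L)
    (hLS : L ^ 2 ≤ S) (hε : 0 < ε) {η : ℝ} (hη : η = stepX ρ μ S ε)
    {B : ℕ} (hB : B = epochLength μ η) {a s d : ℕ → ℝ}
    (descent : ∀ t, a (t + 1) ≤ a t + 2 * ρ * η * d t - η / 4 * s t + ρ * η ^ 2 * S)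
    (gap : ∀ j k, k ≤ B → ∑ i ∈ Finset.range k, d (j * B + i) ≤
      η * S * k ^ 2 + S / (2 * μ) * (1 + Real.log k))
    (s_le : ∀ t, s t ≤ 4 * ρ * (a t - I)) (s_le_sq : ∀ t, s t ≤ L ^ 2)
    (le_a : ∀ t, I ≤ a t) (a_le : ∀ t, a t ≤ I + Δ + η * S * t) {T : ℕ}
    (hT : ⌊20000000 * complexity ρ μ S Δ ε⌋₊ ≤ T) :
    1 / ((T : ℝ) + 1) * ∑ t ∈ Finset.range (T + 1), s t ≤ ε ^ 2 := by
  have hS : 0 < S := lt_of_lt_of_le (by positivity) hLS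
  have hη0 : 0 < η := hη ▸ stepX_pos hρ hμ hS hε
  have hη1 : 48 * (ρ * S * η) ≤ ε ^ 2 := hη ▸ stepX_le hρ hS
  obtain ⟨κ, hκ⟩ : ∃ κ, κ = ρ * S / (μ * ε ^ 2) := ⟨_, rfl⟩
  obtain ⟨m, hm⟩ : ∃ m, m = max 1 (Real.log (1 + 4096 * κ ^ 2)) := ⟨_, rfl⟩
  obtain ⟨M, hM⟩ : ∃ M, M = max 1 (max κ (κ * Real.log (1 + κ ^ 2) ^ 2)) := ⟨_, rfl⟩
  have hκ0 : 0 < κ := by rw [hκ]; positivity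
  have hκε : μ * κ * ε ^ 2 = ρ * S := by rw [hκ]; field_simp
  have hm1 : 1 ≤ m := hm ▸ le_max_left _ _
  have hM1 : 1 ≤ M := hM ▸ le_max_left _ _
  have hM2 : κ ≤ M := hM ▸ (le_max_left _ _).trans (le_max_right _ _)
  have hη2 : (64 * κ * m) ^ 2 * (μ * η) ≤ 1 := by
    rw [hη, hm]; exact sq_mul_stepX_le hρ hμ hS hε hκ
  have hη3 : 1 ≤ η * (671744 * (μ * κ) * M) := hη ▸ one_le_stepX_mul hρ hμ hS hε hκ hM
  have hΔ : 0 ≤ Δ := by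
    have h1 := a_le 0
    have h2 := le_a 0
    simp only [Nat.cast_zero, mul_zero] at h1
    linarith
  have hμη : 0 < μ * η := by positivity
  obtain ⟨r, hr⟩ : ∃ r, r = √(1 / (μ * η)) := ⟨_, rfl⟩
  have hr0 : 0 ≤ r := hr ▸ Real.sqrt_nonneg _
  have hr2 : r ^ 2 * (μ * η) = 1 := by
    rw [hr, Real.sq_sqrt (by positivity)]; field_simp
  have hBr : (B : ℝ) ≤ r + 1 := by
    rw [hB, epochLength, ← hr]
    push_cast
    linarith [Nat.floor_le hr0]
  have hrB : r ≤ B := by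
    rw [hB, epochLength, ← hr]
    push_cast
    exact (Nat.lt_floor_add_one r).le
  have hbr : 64 * κ * m ≤ r := by
    refine le_of_sq_le_sq ?_ hr0
    exact le_of_mul_le_mul_right (hη2.trans_eq hr2.symm) hμη
  have hB0 : 0 < B := by rw [hB, epochLength]; omega
  have hB1 : (1 : ℝ) ≤ B := by exact_mod_cast hB0
  -- `1/64` comes from `64 κ ≤ r`, and `1/48` from the `+ 1` in `B ≤ r + 1` with the first entry of
  -- the step size.
  have hdrift : ρ * S * η * B ≤ (1 / 64 + 1 / 48) * ε ^ 2 := by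
    have h1 : 64 * κ ≤ r := by nlinarith
    have h2 : 64 * κ * (r * (μ * η)) ≤ 1 := by
      rw [← hr2, sq, mul_assoc r r]
      exact mul_le_mul_of_nonneg_right h1 (by positivity)
    have h3 : 64 * (ρ * S * η * r) ≤ ε ^ 2 := by
      rw [← hκε]
      have := mul_le_mul_of_nonneg_right h2 (sq_nonneg ε)
      linarith
    have h4 := mul_le_mul_of_nonneg_left hBr (by positivity : 0 ≤ ρ * S * η)
    linarith
  have hlog := epochLength_mul_log_le hκ0 hm hB1 (hbr.trans hrB)
  have hN : 20000000 * (ρ * S * Δ / ε ^ 4 * M) < (T : ℝ) + 1 := by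
    rw [← complexity_eq hκ hM]
    exact_mod_cast (Nat.floor_lt' (Nat.succ_ne_zero T)).1 (Nat.lt_succ_of_le hT)
  rw [one_div_mul_eq_div, div_le_iff₀ (by positivity)]
  -- Below one epoch, `n / B + 1` is not bounded by `2 n / B`. There `20000000 N < T + 1 < B ≤ 821
  -- M` forces `ρ Δ` to be a tiny multiple of `ε²`, unless `L ≤ ε` already settles the claim; each
  -- term is then bounded separately.
  rcases lt_or_ge (T + 1) B with hTB | hTB
  · have hs : ∀ t ∈ Finset.range (T + 1), s t ≤ ε ^ 2 := by
      intro t ht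
      rcases le_or_gt (L ^ 2) (ε ^ 2) with hLε | hLε
      · exact (s_le_sq t).trans hLε
      have htB : (t : ℝ) ≤ B := by
        have := Finset.mem_range.1 ht
        exact_mod_cast (by omega : t ≤ B)
      -- `820² = 672400` exceeds `671744`.
      have h1 : r ≤ 820 * M := by
        refine le_of_sq_le_sq ?_ (by positivity)
        refine le_of_mul_le_mul_right ?_ hμη
        rw [hr2]
        refine hη3.trans ?_
        have h2 := mul_le_mul_of_nonneg_left hM2 (by positivity : 0 ≤ 671744 * (μ * η) * M)
        have h3 : 0 ≤ μ * η * M ^ 2 := by positivity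
        linarith
      have h2 : (T : ℝ) + 1 < B := by exact_mod_cast hTB
      have h3 : 20000000 * (ρ * S * Δ / ε ^ 4) * M < 821 * M := by linarith
      have h4 := lt_of_mul_lt_mul_right h3 (by linarith)
      have h5 : 20000000 * (ρ * S * Δ) < 821 * ε ^ 4 := by
        rw [← mul_div_assoc, div_lt_iff₀ (by positivity)] at h4
        exact h4
      have h6 : 20000000 * (ρ * Δ) ≤ 821 * ε ^ 2 := by
        have h7 : ρ * Δ * ε ^ 2 ≤ ρ * Δ * S := by gcongr; linarith
        refine le_of_mul_le_mul_right ?_ (pow_pos hε 2)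
        linarith
      have h8 := mul_le_mul_of_nonneg_left htB (by positivity : 0 ≤ ρ * S * η)
      have h9 := mul_le_mul_of_nonneg_left (a_le t) (by positivity : 0 ≤ 4 * ρ)
      have h10 := s_le t
      have h11 := sq_nonneg ε
      linarith
    refine (Finset.sum_le_card_nsmul _ _ _ hs).trans_eq ?_
    rw [Finset.card_range, nsmul_eq_mul]
    push_cast
    ring
  · obtain ⟨n, hn⟩ : ∃ n, n = T + 1 := ⟨_, rfl⟩
    have hnT : (n : ℝ) = T + 1 := by rw [hn]; push_cast; rfl
    rw [← hn] at hTB ⊢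
    rw [← hnT] at hN ⊢
    have hgap := sum_range_le_of_blocks hB0 (d := d) (c₁ := η * S * B)
      (c₂ := S / (2 * μ) * (1 + Real.log B)) (fun j k hk => by
        refine (gap j k hk).trans ?_
        have hkB : (k : ℝ) ≤ B := by exact_mod_cast hk
        have h1 : Real.log k ≤ Real.log B := by
          rcases Nat.eq_zero_or_pos k with rfl | hk0
          · simpa using Real.log_nonneg hB1
          · exact Real.log_le_log (by exact_mod_cast hk0) hkB
        have h2 := mul_le_mul_of_nonneg_left hkB (by positivity : 0 ≤ η * S * k)
        have h3 := mul_le_mul_of_nonneg_left h1 (by positivity : 0 ≤ S / (2 * μ))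
        linarith) n
    have hsum : ∀ n : ℕ, η / 4 * ∑ t ∈ Finset.range n, s t ≤
        a 0 - a n + 2 * ρ * η * ∑ t ∈ Finset.range n, d t + ρ * η ^ 2 * S * n := by
      intro n
      induction n with
      | zero => simp
      | succ n ih =>
        rw [Finset.sum_range_succ, Finset.sum_range_succ]
        have := descent n
        push_cast
        linarith
    have h1 := hsum n
    have h2 := le_a n
    have h3 := a_le 0
    simp only [Nat.cast_zero, mul_zero, add_zero] at h3
    have hq : ((n / B : ℕ) + 1 : ℝ) * B ≤ 2 * n := by
      have h4 : n / B * B ≤ n := Nat.div_mul_le_self n B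
      have h5 : ((n / B : ℕ) : ℝ) * B ≤ n := by exact_mod_cast h4
      have h6 : (B : ℝ) ≤ n := by exact_mod_cast hTB
      linarith
    have h7 : 2 * ρ * (((n / B : ℕ) + 1) * (S / (2 * μ) * (1 + Real.log B))) ≤
        3 / 64 * ε ^ 2 * n := by
      have h8 : ρ * S / μ = κ * ε ^ 2 := by rw [hκ]; field_simp
      have h9 : 2 * ρ * (((n / B : ℕ) + 1) * (S / (2 * μ) * (1 + Real.log B))) =
          ((n / B : ℕ) + 1) * (1 / 4 * ε ^ 2 * (4 * κ * (1 + Real.log B))) := by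
        rw [show 2 * ρ * (((n / B : ℕ) + 1) * (S / (2 * μ) * (1 + Real.log B))) =
          ρ * S / μ * ((((n / B : ℕ) : ℝ) + 1) * (1 + Real.log B)) by ring, h8]
        ring
      rw [h9]
      have h10 := mul_le_mul_of_nonneg_left hlog
        (by positivity : 0 ≤ (((n / B : ℕ) : ℝ) + 1) * (1 / 4 * ε ^ 2))
      have h11 := mul_le_mul_of_nonneg_left hq (by positivity : 0 ≤ ε ^ 2 * (3 / 128))
      linarith
    -- The error budget, in units of `η ε² n`: `1/16` for `Δ`, `7/96` for the drift, `3/64` for the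
    -- regret and `1/48` for the `η²` term; the total `39/192` is below the available `1/4`.
    have h12 : Δ ≤ η * (1 / 16 * ε ^ 2 * n) := by
      have h13 : ρ * S * Δ / ε ^ 4 * M = μ * κ * M * Δ / ε ^ 2 := by
        rw [← hκε]; field_simp
      rw [h13, ← mul_div_assoc, div_lt_iff₀ (by positivity)] at hN
      have h14 := mul_le_mul_of_nonneg_left hη3 hΔ
      have h15 := mul_le_mul_of_nonneg_left hN.le hη0.le
      have h16 : 0 ≤ η * (ε ^ 2 * n) := by positivity
      linarith
    have h17 := mul_le_mul_of_nonneg_left hgap (by positivity : 0 ≤ 2 * ρ * η)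
    have h18 := mul_le_mul_of_nonneg_left h7 hη0.le
    have h19 := mul_le_mul_of_nonneg_left hdrift (by positivity : 0 ≤ 2 * η * n)
    have h20 := mul_le_mul_of_nonneg_left hη1 (by positivity : 0 ≤ η * n)
    refine le_of_mul_le_mul_left ?_ (by positivity : 0 < η / 4)
    have h21 : 0 ≤ η * (ε ^ 2 * n) := by positivity
    linarith

/-! ### The rate for processes with mean subgradient inequalities -/

theorem stepY_eq {μ : ℝ} {B i : ℕ} (j : ℕ) (hi : i < B) :
    stepY μ B (j * B + i + 1) = 1 / (μ * (i + 1)) := by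
  have h1 : (j * B + i) / B = j := by
    rw [mul_comm, Nat.mul_add_div (by omega), Nat.div_eq_of_lt hi, add_zero]
  rw [stepY, Nat.add_sub_cancel, h1]
  push_cast
  congr 2
  ring

section Iterates

variable {E F Ω : Type*} [NormedAddCommGroup E] [InnerProductSpace ℝ E] [ProperSpace E]
  [MeasurableSpace E] [BorelSpace E]
  [NormedAddCommGroup F] [InnerProductSpace ℝ F] [ProperSpace F]
  [MeasurableSpace F] [BorelSpace F] [MeasurableSpace Ω]

theorem IsMeanSubgradientProcess.average_stationarity_sq_le
    {f : E → F → ℝ} {U Y : Set F} {L ρ μ S ε : ℝ} {P : Measure Ω} [IsProbabilityMeasure P]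
    {x₀ : E} {X : ℕ → Ω → E} {V : ℕ → Ω → F} {A : ℕ → Ω → E} {D : ℕ → Ω → F}
    (hp : IsMeanSubgradientProcess f Y ρ μ S (stepX ρ μ S ε)
      (stepY μ (epochLength μ (stepX ρ μ S ε))) P x₀ X V A D)
    (h : Assumptions f U Y L ρ μ) (hb : BddBelow (Set.range (Phi f Y)))
    (hS : L ^ 2 ≤ S) (hε : 0 < ε) {T : ℕ}
    (hT : ⌊20000000 * complexity ρ μ S (DeltaPhi f Y x₀) ε⌋₊ ≤ T) :
    1 / ((T : ℝ) + 1) * ∑ t ∈ Finset.range (T + 1),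
      ∫ ω, stationarity ρ (Phi f Y) (X t ω) ^ 2 ∂P ≤ ε ^ 2 := by
  have hη := stepX_pos h.rho_pos h.mu_pos (lt_of_lt_of_le (pow_pos h.L_pos 2) hS) hε
  exact average_le h.rho_pos h.mu_pos h.L_pos hS hε rfl rfl
    (hp.integral_moreauEnvelope_succ_le h hb hη.le)
    (fun j k hk => hp.sum_integral_gap_le h hη.le hS (j * _) k
      fun i hi => stepY_eq j (hi.trans_le hk))
    (hp.integral_stationarity_sq_le_mul h hb) (hp.integral_stationarity_sq_le h hb)
    (hp.iInf_le_integral_moreauEnvelope h hb) (hp.integral_moreauEnvelope_le h hb hη.le hS) hT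

/-! ### Deterministic iterates -/

theorem IsTTGDA.exists_isMeanSubgradientProcess
    {f : E → F → ℝ} {U Y : Set F} {L ρ μ η : ℝ} {ηy : ℕ → ℝ} {x₀ : E} {y₀ : F}
    {x : ℕ → E} {y : ℕ → F} (h : Assumptions f U Y L ρ μ) (hy₀ : y₀ ∈ Y)
    (hxy : IsTTGDA f U Y ρ (fun _ => η) ηy x₀ y₀ x y) :
    ∃ (A : ℕ → Unit → E) (D : ℕ → Unit → F),
      IsMeanSubgradientProcess f Y ρ μ (L ^ 2) η ηy (Measure.dirac ()) x₀
        (fun t _ => x t) (fun t _ => y t) A D := by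
  choose gx gy hg hx hy using hxy.step
  have hyY : ∀ t, y t ∈ Y := by
    rintro (_ | t)
    · rw [hxy.y_zero]; exact hy₀
    · exact (hy t).1
  refine ⟨fun t _ => gx t, fun t _ => gy t, ?_⟩
  constructor
  · exact fun t => measurable_const
  · exact fun t => measurable_const
  · exact fun t => memLp_const _
  · exact fun t => memLp_const _
  · intro t
    simpa using pow_le_pow_left₀ (norm_nonneg _)
      (h.norm_le_of_mem_weakSubdifferential (hyY t) (hg t).1) 2
  · intro t
    simpa using pow_le_pow_left₀ (norm_nonneg _)
      (h.norm_le_of_mem_superdifferentialOn (hyY t) (hg t).2) 2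
  · exact fun _ => hxy.x_zero
  · exact fun t _ => hyY t
  · exact fun t _ => hx t
  · exact fun t _ => hy t
  · intro t q _ _
    simpa using Assumptions.inner_le_of_mem_weakSubdifferential (hg t).1 (q (x t))
  · intro s t _ u _ huY
    simpa using h.le_inner_of_mem_superdifferentialOn (hyY t) (hg t).2 (huY (x s))

end Iterates

/-! ### Random iterates driven by independent samples -/

section Independence

variable {Ω γ Ξ : Type*} [MeasurableSpace Ω] [MeasurableSpace γ] [MeasurableSpace Ξ]
  {P : Measure Ω} [IsProbabilityMeasure P] {ν : Measure Ξ} {Z : Ω → γ} {ζ : Ω → Ξ}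

/-- Tonelli for the product law of the past and the new sample. No integrability is presupposed, so
it can establish the finite second moments that the Fubini version below relies on. -/
theorem lintegral_comp_le_of_indepFun (hZ : Measurable Z) (hζ : Measurable ζ)
    (hind : IndepFun Z ζ P) (hν : P.map ζ = ν) {H : γ × Ξ → ENNReal} (hH : Measurable H)
    {c : ENNReal} (hc : ∀ ω, ∫⁻ s, H (Z ω, s) ∂ν ≤ c) : ∫⁻ ω, H (Z ω, ζ ω) ∂P ≤ c := by
  have : IsProbabilityMeasure ν := hν ▸ Measure.isProbabilityMeasure_map hζ.aemeasurable
  have h1 := (indepFun_iff_map_prod_eq_prod_map_map hZ.aemeasurable hζ.aemeasurable).1 hind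
  rw [hν] at h1
  rw [← lintegral_map hH (hZ.prodMk hζ), h1, lintegral_prod _ hH.aemeasurable,
    lintegral_map hH.lintegral_prod_right' hZ]
  calc ∫⁻ ω, ∫⁻ s, H (Z ω, s) ∂ν ∂P ≤ ∫⁻ _, c ∂P := lintegral_mono hc
    _ = c := by simp

theorem integral_comp_le_of_indepFun (hZ : Measurable Z) (hζ : Measurable ζ)
    (hind : IndepFun Z ζ P) (hν : P.map ζ = ν) {H : γ × Ξ → ℝ} (hH : Measurable H)
    (hint : Integrable (fun ω => H (Z ω, ζ ω)) P) {K : Ω → ℝ} (hK : Integrable K P)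
    (hle : ∀ ω, ∫ s, H (Z ω, s) ∂ν ≤ K ω) : ∫ ω, H (Z ω, ζ ω) ∂P ≤ ∫ ω, K ω ∂P := by
  have : IsProbabilityMeasure ν := hν ▸ Measure.isProbabilityMeasure_map hζ.aemeasurable
  have : IsProbabilityMeasure (P.map Z) := Measure.isProbabilityMeasure_map hZ.aemeasurable
  have h1 := (indepFun_iff_map_prod_eq_prod_map_map hZ.aemeasurable hζ.aemeasurable).1 hind
  rw [hν] at h1
  have hint' : Integrable H ((P.map Z).prod ν) := by
    rw [← h1]
    exact (integrable_map_measure hH.aestronglyMeasurable (hZ.prodMk hζ).aemeasurable).2 hint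
  have h2 := hint'.integral_prod_left
  rw [← integral_map (hZ.prodMk hζ).aemeasurable hH.aestronglyMeasurable, h1,
    integral_prod _ hint', integral_map hZ.aemeasurable h2.1]
  exact integral_mono ((integrable_map_measure h2.1 hZ.aemeasurable).1 h2) hK hle

/-- The `σ`-algebra generated by the samples before time `t`. -/
abbrev pastSamples (ξ : ℕ → Ω → Ξ) (t : ℕ) : MeasurableSpace Ω :=
  ⨆ i ∈ Set.Iio t, MeasurableSpace.comap (ξ i) inferInstance

theorem pastSamples_mono (ξ : ℕ → Ω → Ξ) {s t : ℕ} (h : s ≤ t) :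
    pastSamples ξ s ≤ pastSamples ξ t :=
  biSup_mono fun _ hi => lt_of_lt_of_le hi h

theorem measurable_pastSamples (ξ : ℕ → Ω → Ξ) (t : ℕ) :
    Measurable[pastSamples ξ (t + 1)] (ξ t) := by
  rw [measurable_iff_comap_le]
  exact le_biSup (fun i => MeasurableSpace.comap (ξ i) inferInstance) (Nat.lt_succ_self t)

theorem pastSamples_le {ξ : ℕ → Ω → Ξ} (hξ : ∀ t, Measurable (ξ t)) (t : ℕ) :
    pastSamples ξ t ≤ inferInstanceAs (MeasurableSpace Ω) :=
  iSup₂_le fun i _ => (hξ i).comap_le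

/-- The index sets `{i < t}` and `{t}` are disjoint, so the σ-algebras generated by their samples
are independent. -/
theorem indepFun_of_measurable_pastSamples {ξ : ℕ → Ω → Ξ} (hξ : ∀ t, Measurable (ξ t))
    (hind : iIndepFun ξ P) {t : ℕ} (hZ : Measurable[pastSamples ξ t] Z) :
    IndepFun Z (ξ t) P := by
  have h1 : Indep (pastSamples ξ t) (⨆ i ∈ ({t} : Set ℕ), MeasurableSpace.comap (ξ i) inferInstance)
      P := indep_iSup_of_disjoint (fun i => (hξ i).comap_le) hind.iIndep (by simp)
  rw [iSup_singleton] at h1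
  rw [IndepFun_iff_Indep]
  exact indep_of_indep_of_le_left h1 hZ.comap_le

theorem measurable_pastSamples_of_recursion {ξ : ℕ → Ω → Ξ} {W : ℕ → Ω → γ} {z₀ : γ}
    (h0 : ∀ ω, W 0 ω = z₀) {Ψ : ℕ → γ × Ξ → γ} (hΨ : ∀ t, Measurable (Ψ t))
    (hstep : ∀ t ω, W (t + 1) ω = Ψ t (W t ω, ξ t ω)) (t : ℕ) :
    Measurable[pastSamples ξ t] (W t) := by
  induction t with
  | zero => rw [funext h0]; exact measurable_const
  | succ t ih =>
    rw [funext (hstep t)]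
    exact (hΨ t).comp ((ih.mono (pastSamples_mono ξ t.le_succ) le_rfl).prodMk
      (measurable_pastSamples ξ t))

end Independence

/-! ### Second moments and mean subgradient inequalities for TTSGDA -/

section StochasticSubgradient

variable {Ω Ξ : Type*} [MeasurableSpace Ω] [MeasurableSpace Ξ]

theorem integral_norm_sq_eq {G : Type*} [NormedAddCommGroup G] [InnerProductSpace ℝ G]
    [CompleteSpace G] {ν : Measure Ξ} [IsProbabilityMeasure ν] {g : Ξ → G} (hg : MemLp g 2 ν) :
    ∫ s, ‖g s‖ ^ 2 ∂ν = ∫ s, ‖g s - ∫ s', g s' ∂ν‖ ^ 2 ∂ν + ‖∫ s, g s ∂ν‖ ^ 2 := by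
  set c := ∫ s, g s ∂ν with hc
  have hgi := hg.integrable one_le_two
  have h1 : Integrable (fun s => ‖g s - c‖ ^ 2) ν := by
    simpa using (hg.sub (memLp_const c)).integrable_norm_pow two_ne_zero
  have h2 : Integrable (fun s => 2 * inner ℝ c (g s)) ν := (hgi.const_inner c).const_mul 2
  have h3 : Integrable (fun s => ‖g s - c‖ ^ 2 + 2 * inner ℝ c (g s)) ν := h1.add h2
  have h4 : ∀ s, ‖g s‖ ^ 2 = ‖g s - c‖ ^ 2 + 2 * inner ℝ c (g s) - ‖c‖ ^ 2 := fun s => by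
    rw [norm_sub_sq_real, real_inner_comm]; ring
  simp_rw [h4]
  rw [integral_sub h3 (integrable_const _), integral_add h1 h2, integral_const_mul,
    integral_inner hgi, ← hc, real_inner_self_eq_norm_sq]
  simp
  ring

variable {E F : Type*} [NormedAddCommGroup E] [InnerProductSpace ℝ E] [ProperSpace E]
  [MeasurableSpace E] [BorelSpace E]
  [NormedAddCommGroup F] [InnerProductSpace ℝ F] [ProperSpace F]
  [MeasurableSpace F] [BorelSpace F]
  {f : E → F → ℝ} {U Y : Set F} {L ρ μ σ η : ℝ} {ηy : ℕ → ℝ} {ν : Measure Ξ}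
  {Gx : E → F → Ξ → E} {Gy : E → F → Ξ → F}

/-- The second moment is the variance plus the squared norm of the mean; the mean is a subgradient,
hence bounded by `L`. -/
theorem IsStochasticSubgradient.integral_norm_sq_le [IsProbabilityMeasure ν]
    (hG : IsStochasticSubgradient f U Y ρ σ ν Gx Gy) (h : Assumptions f U Y L ρ μ)
    (x : E) {y : F} (hy : y ∈ Y) :
    ∫ s, ‖Gx x y s‖ ^ 2 ∂ν ≤ L ^ 2 + σ ^ 2 ∧ ∫ s, ‖Gy x y s‖ ^ 2 ∂ν ≤ L ^ 2 + σ ^ 2 := by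
  have hx := hG.memLp_x x y hy
  have hy' := hG.memLp_y x y hy
  have hv := hG.variance_le x y hy
  have ix : Integrable (fun s => ‖Gx x y s - ∫ s', Gx x y s' ∂ν‖ ^ 2) ν := by
    simpa using (hx.sub (memLp_const _)).integrable_norm_pow two_ne_zero
  have iy : Integrable (fun s => ‖Gy x y s - ∫ s', Gy x y s' ∂ν‖ ^ 2) ν := by
    simpa using (hy'.sub (memLp_const _)).integrable_norm_pow two_ne_zero
  rw [integral_add ix iy] at hv
  have nx : 0 ≤ ∫ s, ‖Gx x y s - ∫ s', Gx x y s' ∂ν‖ ^ 2 ∂ν := integral_nonneg fun _ => sq_nonneg _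
  have ny : 0 ≤ ∫ s, ‖Gy x y s - ∫ s', Gy x y s' ∂ν‖ ^ 2 ∂ν := integral_nonneg fun _ => sq_nonneg _
  have mx := pow_le_pow_left₀ (norm_nonneg _)
    (h.norm_le_of_mem_weakSubdifferential hy (hG.unbiased x y hy).1) 2
  have my := pow_le_pow_left₀ (norm_nonneg _)
    (h.norm_le_of_mem_superdifferentialOn hy (hG.unbiased x y hy).2) 2
  rw [integral_norm_sq_eq hx, integral_norm_sq_eq hy']
  constructor <;> linarith

variable {P : Measure Ω} [IsProbabilityMeasure P]

theorem memLp_comp_of_indepFun {γ G : Type*} [MeasurableSpace γ]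
    [NormedAddCommGroup G] [MeasurableSpace G] [BorelSpace G] [SecondCountableTopology G]
    {Z : Ω → γ} {ζ : Ω → Ξ} (hZ : Measurable Z) (hζ : Measurable ζ)
    (hind : IndepFun Z ζ P) (hν : P.map ζ = ν) {H : γ × Ξ → G} (hH : Measurable H) {c : ℝ}
    (hc0 : 0 ≤ c) (hm : ∀ ω, MemLp (fun s => H (Z ω, s)) 2 ν)
    (hc : ∀ ω, ∫ s, ‖H (Z ω, s)‖ ^ 2 ∂ν ≤ c) :
    MemLp (fun ω => H (Z ω, ζ ω)) 2 P ∧ ∫ ω, ‖H (Z ω, ζ ω)‖ ^ 2 ∂P ≤ c := by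
  have hHm : Measurable fun ω => H (Z ω, ζ ω) := hH.comp (hZ.prodMk hζ)
  have h1 : ∫⁻ ω, ENNReal.ofReal (‖H (Z ω, ζ ω)‖ ^ 2) ∂P ≤ ENNReal.ofReal c := by
    refine lintegral_comp_le_of_indepFun (H := fun p => ENNReal.ofReal (‖H p‖ ^ 2)) hZ hζ hind hν
      (hH.norm.pow_const 2).ennreal_ofReal fun ω => ?_
    have hi : Integrable (fun s => ‖H (Z ω, s)‖ ^ 2) ν := by
      simpa using (hm ω).integrable_norm_pow two_ne_zero
    rw [← ofReal_integral_eq_lintegral_ofReal hi (Filter.Eventually.of_forall fun _ => sq_nonneg _)]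
    exact ENNReal.ofReal_le_ofReal (hc ω)
  have h2 : Integrable (fun ω => ‖H (Z ω, ζ ω)‖ ^ 2) P := by
    refine ⟨(hHm.norm.pow_const 2).aestronglyMeasurable, ?_⟩
    rw [hasFiniteIntegral_iff_ofReal (Filter.Eventually.of_forall fun _ => sq_nonneg _)]
    exact h1.trans_lt ENNReal.ofReal_lt_top
  refine ⟨(memLp_two_iff_integrable_sq_norm hHm.aestronglyMeasurable).2 h2, ?_⟩
  rw [← ofReal_integral_eq_lintegral_ofReal h2
    (Filter.Eventually.of_forall fun _ => sq_nonneg _)] at h1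
  exact (ENNReal.ofReal_le_ofReal_iff hc0).1 h1

variable {ξ : ℕ → Ω → Ξ} {x₀ : E} {y₀ : F} {X : ℕ → Ω → E} {V : ℕ → Ω → F}

theorem IsTTSGDA.mem (hXV : IsTTSGDA Gx Gy Y (fun _ => η) ηy x₀ y₀ ξ X V) (hy₀ : y₀ ∈ Y)
    (t : ℕ) (ω : Ω) : V t ω ∈ Y := by
  cases t with
  | zero => rw [hXV.y_zero]; exact hy₀
  | succ t => exact (hXV.y_step t ω).1

theorem IsTTSGDA.measurable_pastSamples (h : Assumptions f U Y L ρ μ)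
    (hG : IsStochasticSubgradient f U Y ρ σ ν Gx Gy)
    (hXV : IsTTSGDA Gx Gy Y (fun _ => η) ηy x₀ y₀ ξ X V) (t : ℕ) :
    Measurable[pastSamples ξ t] fun ω => (X t ω, V t ω) := by
  choose π hπ using exists_isProjection h.isClosed h.nonempty
  have hπc : Continuous π := by
    have : LipschitzWith (1 : ℝ).toNNReal π := LipschitzWith.of_dist_le' fun z z' => by
      rw [dist_eq_norm, dist_eq_norm, one_mul]
      exact (hπ z).norm_sub_le_norm_sub h.convex (hπ z')
    exact this.continuous
  have hassoc : Measurable fun p : (E × F) × Ξ => (p.1.1, p.1.2, p.2) := by fun_prop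
  have hx := hG.measurable_x.comp hassoc
  have hy := hG.measurable_y.comp hassoc
  refine measurable_pastSamples_of_recursion (z₀ := (x₀, y₀))
    (W := fun t ω => (X t ω, V t ω))
    (Ψ := fun t p => (p.1.1 - η • Gx p.1.1 p.1.2 p.2, π (p.1.2 + ηy (t + 1) • Gy p.1.1 p.1.2 p.2)))
    (fun ω => by rw [hXV.x_zero, hXV.y_zero]) (fun t => ?_) (fun t ω => ?_) t
  · exact ((measurable_fst.comp measurable_fst).sub (hx.const_smul η)).prodMk
      (hπc.measurable.comp ((measurable_snd.comp measurable_fst).add (hy.const_smul _)))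
  -- Nonexpansiveness with equal inputs is uniqueness of the projection, so the given iterate agrees
  -- with the measurable map `π`.
  · have h1 := (hXV.y_step t ω).norm_sub_le_norm_sub h.convex
      (hπ (V t ω + ηy (t + 1) • Gy (X t ω) (V t ω) (ξ t ω)))
    rw [sub_self, norm_zero, norm_le_zero_iff, sub_eq_zero] at h1
    simp only [hXV.x_step, h1]

theorem IsTTSGDA.isMeanSubgradientProcess [IsProbabilityMeasure ν]
    (h : Assumptions f U Y L ρ μ) (hy₀ : y₀ ∈ Y)
    (hG : IsStochasticSubgradient f U Y ρ σ ν Gx Gy) (hξ : ∀ t, Measurable (ξ t))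
    (hind : iIndepFun ξ P) (hν : ∀ t, P.map (ξ t) = ν)
    (hXV : IsTTSGDA Gx Gy Y (fun _ => η) ηy x₀ y₀ ξ X V) :
    IsMeanSubgradientProcess f Y ρ μ (L ^ 2 + σ ^ 2) η ηy P x₀ X V
      (fun t ω => Gx (X t ω) (V t ω) (ξ t ω)) (fun t ω => Gy (X t ω) (V t ω) (ξ t ω)) := by
  have hpast := hXV.measurable_pastSamples h hG
  have hW : ∀ t, Measurable fun ω => (X t ω, V t ω) := fun t =>
    (hpast t).mono (pastSamples_le hξ t) le_rfl
  have hXm : ∀ t, Measurable (X t) := fun t => measurable_fst.comp (hW t)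
  have hVm : ∀ t, Measurable (V t) := fun t => measurable_snd.comp (hW t)
  have hVY := hXV.mem hy₀
  have hWind := fun t => indepFun_of_measurable_pastSamples hξ hind (hpast t)
  have hassoc : Measurable fun p : (E × F) × Ξ => (p.1.1, p.1.2, p.2) := by fun_prop
  have hx := hG.measurable_x.comp hassoc
  have hy := hG.measurable_y.comp hassoc
  have hS : 0 ≤ L ^ 2 + σ ^ 2 := by positivity
  have hA := fun t => memLp_comp_of_indepFun (hW t) (hξ t) (hWind t) (hν t) hx hS
    (fun ω => hG.memLp_x (X t ω) (V t ω) (hVY t ω))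
    (fun ω => (hG.integral_norm_sq_le h (X t ω) (hVY t ω)).1)
  have hD := fun t => memLp_comp_of_indepFun (hW t) (hξ t) (hWind t) (hν t) hy hS
    (fun ω => hG.memLp_y (X t ω) (V t ω) (hVY t ω))
    (fun ω => (hG.integral_norm_sq_le h (X t ω) (hVY t ω)).2)
  constructor
  · exact hXm
  · exact hVm
  · exact fun t => (hA t).1
  · exact fun t => (hD t).1
  · exact fun t => (hA t).2
  · exact fun t => (hD t).2
  · exact hXV.x_zero
  · exact hVY
  · exact hXV.x_step
  · exact hXV.y_step
  · rintro t q hq ⟨c, hc⟩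
    have hqm : Measurable fun ω => q (X t ω) - X t ω := (hq.measurable.comp (hXm t)).sub (hXm t)
    refine integral_comp_le_of_indepFun
      (H := fun p : (E × F) × Ξ => inner ℝ (Gx p.1.1 p.1.2 p.2) (q p.1.1 - p.1.1))
      (hW t) (hξ t) (hWind t) (hν t) ?_ ?_ ?_ fun ω => ?_
    · have hq' : Measurable fun p : (E × F) × Ξ => q p.1.1 - p.1.1 :=
        (hq.measurable.comp (measurable_fst.comp measurable_fst)).sub
          (measurable_fst.comp measurable_fst)
      exact hx.inner hq'
    · exact integrable_inner_of_bounded ((hA t).1.integrable one_le_two) hqm.aestronglyMeasurable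
        fun ω => hc _
    · refine Integrable.add ?_ (Integrable.const_mul ?_ _)
      · refine integrable_of_abs_le (c := L * c) ?_ fun ω => ?_
        · exact (h.measurable_comp (hq.measurable.comp (hXm t)) (hVm t) (hVY t)).sub
            (h.measurable_comp (hXm t) (hVm t) (hVY t))
        · exact (h.abs_sub_le_left _ _ (h.subset (hVY t ω))).trans
            (mul_le_mul_of_nonneg_left (hc _) h.L_pos.le)
      · refine integrable_of_abs_le (c := c ^ 2) (hqm.norm.pow_const 2) fun ω => ?_
        rw [abs_of_nonneg (sq_nonneg _)]
        exact pow_le_pow_left₀ (norm_nonneg _) (hc _) 2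
    · simp only [real_inner_comm (q (X t ω) - X t ω)]
      rw [integral_inner ((hG.memLp_x _ _ (hVY t ω)).integrable one_le_two), real_inner_comm]
      exact Assumptions.inner_le_of_mem_weakSubdifferential (hG.unbiased _ _ (hVY t ω)).1 _
  · intro s t hst u hu huY
    obtain ⟨c, hc⟩ := h.exists_norm_sub_le
    have hpast' : Measurable[pastSamples ξ t] fun ω => (X s ω, X t ω, V t ω) :=
      (measurable_fst.comp ((hpast s).mono (pastSamples_mono ξ hst) le_rfl)).prodMk (hpast t)
    have hum : Measurable fun ω => u (X s ω) := hu.measurable.comp (hXm s)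
    -- The transfer lemma gives upper bounds and a lower bound is wanted, so it is applied to the
    -- negated inner product. The past variable includes `X s`, on which the test point depends.
    have key := integral_comp_le_of_indepFun
      (Z := fun ω => (X s ω, X t ω, V t ω))
      (H := fun p : (E × E × F) × Ξ => inner ℝ (Gy p.1.2.1 p.1.2.2 p.2) (p.1.2.2 - u p.1.1))
      (K := fun ω => -(f (X t ω) (u (X s ω)) - f (X t ω) (V t ω) +
        μ / 2 * ‖u (X s ω) - V t ω‖ ^ 2))
      ((hXm s).prodMk (hW t)) (hξ t) (indepFun_of_measurable_pastSamples hξ hind hpast') (hν t)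
      ?_ ?_ ?_ fun ω => ?_
    · rw [integral_neg] at key
      rw [← neg_le_neg_iff, ← integral_neg]
      simpa only [← inner_neg_right, neg_sub] using key
    · have h1 : Measurable fun p : (E × E × F) × Ξ => (p.1.2.1, p.1.2.2, p.2) := by fun_prop
      have h2 : Measurable fun p : (E × E × F) × Ξ => p.1.2.2 - u p.1.1 :=
        (measurable_snd.comp (measurable_snd.comp measurable_fst)).sub
          (hu.measurable.comp (measurable_fst.comp measurable_fst))
      exact (hG.measurable_y.comp h1).inner h2
    · exact integrable_inner_of_bounded ((hD t).1.integrable one_le_two)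
        ((hVm t).sub hum).aestronglyMeasurable fun ω => hc _ (hVY t ω) _ (huY _)
    · refine (Integrable.add ?_ (Integrable.const_mul ?_ _)).neg
      · refine integrable_of_abs_le (c := L * c) ?_ fun ω => ?_
        · exact (h.measurable_comp (hXm t) hum fun ω => huY _).sub
            (h.measurable_comp (hXm t) (hVm t) (hVY t))
        · exact (h.abs_sub_le_right _ (h.subset (huY _)) (h.subset (hVY t ω))).trans
            (mul_le_mul_of_nonneg_left (hc _ (huY _) _ (hVY t ω)) h.L_pos.le)
      · refine integrable_of_abs_le (c := c ^ 2) ((hum.sub (hVm t)).norm.pow_const 2) fun ω => ?_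
        rw [abs_of_nonneg (sq_nonneg _)]
        exact pow_le_pow_left₀ (norm_nonneg _) (hc _ (huY _) _ (hVY t ω)) 2
    · simp only [real_inner_comm (V t ω - u (X s ω))]
      rw [integral_inner ((hG.memLp_y _ _ (hVY t ω)).integrable one_le_two), real_inner_comm,
        ← neg_sub (u (X s ω)), inner_neg_right, neg_le_neg_iff]
      exact h.le_inner_of_mem_superdifferentialOn (hVY t ω) (hG.unbiased _ _ (hVY t ω)).2 (huY _)

end StochasticSubgradient

end TwoTimescale

end

/-! ### Assembly for both algorithms -/

theorem mainTheorem1 :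
    ∃ C : ℝ, 0 < C ∧
      -- TTGDA
      (∀ (m n : ℕ) (f : EuclideanSpace ℝ (Fin m) → EuclideanSpace ℝ (Fin n) → ℝ)
        (U Y : Set (EuclideanSpace ℝ (Fin n))) (L ρ μ ε : ℝ),
        TwoTimescale.Assumptions f U Y L ρ μ →
        BddBelow (Set.range (TwoTimescale.Phi f Y)) →
        0 < ε →
        ∀ (x₀ : EuclideanSpace ℝ (Fin m)), ∀ y₀ ∈ Y,
        ∀ (x : ℕ → EuclideanSpace ℝ (Fin m)) (y : ℕ → EuclideanSpace ℝ (Fin n)),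
        TwoTimescale.IsTTGDA f U Y ρ
          (fun _ => TwoTimescale.stepX ρ μ (L ^ 2) ε)
          (TwoTimescale.stepY μ
            (TwoTimescale.epochLength μ (TwoTimescale.stepX ρ μ (L ^ 2) ε)))
          x₀ y₀ x y →
        TwoTimescale.WeaklyConvex ρ (TwoTimescale.Phi f Y) ∧
        Differentiable ℝ (TwoTimescale.moreauEnvelope (1 / (2 * ρ)) (TwoTimescale.Phi f Y)) ∧
        ∀ T : ℕ,
          ⌊C * TwoTimescale.complexity ρ μ (L ^ 2) (TwoTimescale.DeltaPhi f Y x₀) ε⌋₊ ≤ T →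
          1 / ((T : ℝ) + 1) * ∑ t ∈ Finset.range (T + 1),
              TwoTimescale.stationarity ρ (TwoTimescale.Phi f Y) (x t) ^ 2 ≤ ε ^ 2 ∧
          ∃ t ≤ T, TwoTimescale.IsStationaryPoint ε ρ (TwoTimescale.Phi f Y) (x t)) ∧
      -- TTSGDA with batch size one
      (∀ (m n : ℕ) (f : EuclideanSpace ℝ (Fin m) → EuclideanSpace ℝ (Fin n) → ℝ)
        (U Y : Set (EuclideanSpace ℝ (Fin n))) (L ρ μ σ ε : ℝ),
        TwoTimescale.Assumptions f U Y L ρ μ →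
        BddBelow (Set.range (TwoTimescale.Phi f Y)) →
        0 ≤ σ → 0 < ε →
        ∀ (Ω Ξ : Type*) [MeasurableSpace Ω] [MeasurableSpace Ξ]
          (P : MeasureTheory.Measure Ω) [MeasureTheory.IsProbabilityMeasure P]
          (ν : MeasureTheory.Measure Ξ) [MeasureTheory.IsProbabilityMeasure ν]
          (Gx : EuclideanSpace ℝ (Fin m) → EuclideanSpace ℝ (Fin n) → Ξ →
            EuclideanSpace ℝ (Fin m))
          (Gy : EuclideanSpace ℝ (Fin m) → EuclideanSpace ℝ (Fin n) → Ξ →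
            EuclideanSpace ℝ (Fin n))
          (ξ : ℕ → Ω → Ξ),
        TwoTimescale.IsStochasticSubgradient f U Y ρ σ ν Gx Gy →
        (∀ t, Measurable (ξ t)) →
        ProbabilityTheory.iIndepFun ξ P →
        (∀ t, MeasureTheory.Measure.map (ξ t) P = ν) →
        ∀ (x₀ : EuclideanSpace ℝ (Fin m)), ∀ y₀ ∈ Y,
        ∀ (X : ℕ → Ω → EuclideanSpace ℝ (Fin m)) (V : ℕ → Ω → EuclideanSpace ℝ (Fin n)),
        TwoTimescale.IsTTSGDA Gx Gy Y
          (fun _ => TwoTimescale.stepX ρ μ (L ^ 2 + σ ^ 2) ε)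
          (TwoTimescale.stepY μ
            (TwoTimescale.epochLength μ (TwoTimescale.stepX ρ μ (L ^ 2 + σ ^ 2) ε)))
          x₀ y₀ ξ X V →
        TwoTimescale.WeaklyConvex ρ (TwoTimescale.Phi f Y) ∧
        Differentiable ℝ (TwoTimescale.moreauEnvelope (1 / (2 * ρ)) (TwoTimescale.Phi f Y)) ∧
        (∀ t, MeasureTheory.Integrable
          (fun ω => TwoTimescale.stationarity ρ (TwoTimescale.Phi f Y) (X t ω) ^ 2) P) ∧
        ∀ T : ℕ,
          ⌊C * TwoTimescale.complexity ρ μ (L ^ 2 + σ ^ 2)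
              (TwoTimescale.DeltaPhi f Y x₀) ε⌋₊ ≤ T →
          1 / ((T : ℝ) + 1) * ∑ t ∈ Finset.range (T + 1),
              ∫ ω, TwoTimescale.stationarity ρ (TwoTimescale.Phi f Y) (X t ω) ^ 2 ∂P ≤ ε ^ 2) := by
  refine ⟨20000000, by norm_num, ?_, ?_⟩
  · intro m n f U Y L ρ μ ε h hb hε x₀ y₀ hy₀ x y hxy
    refine ⟨h.weaklyConvex_Phi, TwoTimescale.differentiable_moreauEnvelope h.rho_pos
      h.weaklyConvex_Phi (h.exists_isProx_Phi hb), fun T hT => ?_⟩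
    obtain ⟨A, D, hp⟩ := hxy.exists_isMeanSubgradientProcess h hy₀
    have key := hp.average_stationarity_sq_le h hb le_rfl hε hT
    simp only [MeasureTheory.integral_const, MeasureTheory.probReal_univ, one_smul] at key
    refine ⟨key, ?_⟩
    -- If all stationarity measures up to `T` exceeded `ε`, the average of their squares would
    -- exceed `ε²`.
    by_contra! hcon
    have hlt : ∑ t ∈ Finset.range (T + 1), ε ^ 2 <
        ∑ t ∈ Finset.range (T + 1),
          TwoTimescale.stationarity ρ (TwoTimescale.Phi f Y) (x t) ^ 2 :=
      Finset.sum_lt_sum_of_nonempty Finset.nonempty_range_add_one fun t ht =>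
        pow_lt_pow_left₀ (not_le.1 (hcon t (Finset.mem_range_succ_iff.1 ht))) hε.le two_ne_zero
    rw [one_div_mul_eq_div, div_le_iff₀ (by positivity)] at key
    rw [Finset.sum_const, Finset.card_range, nsmul_eq_mul] at hlt
    push_cast at hlt
    linarith
  · intro m n f U Y L ρ μ σ ε h hb _ hε Ω Ξ _ _ P _ ν _ Gx Gy ξ hG hξ hind hν x₀ y₀ hy₀ X V hXV
    have hp := hXV.isMeanSubgradientProcess h hy₀ hG hξ hind hν
    exact ⟨h.weaklyConvex_Phi, TwoTimescale.differentiable_moreauEnvelope h.rho_pos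
      h.weaklyConvex_Phi (h.exists_isProx_Phi hb), hp.integrable_stationarity_sq h hb,
      fun T hT => hp.average_stationarity_sq_le h hb (le_add_of_nonneg_right (sq_nonneg σ)) hε hT⟩
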